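/- For $r>1$ let $\phi_r(s)=|s|^{r-2}s$. Let $2<p<q$, $p'=p/(p-1)$, and consider the positive periodic solutions $w:\mathbb R\to(0,\infty)$ of $$\big(\phi_p(w')\big)'+\phi_q(w)-\phi_p(w)=0\quad\text{on }\mathbb R,$$ that is, the positive periodic functions $w$ such that $w$ and $\phi_p(w')$ are differentiable and the equation holds at every point. Let $V(w)=\frac1q|w|^q-\frac1p|w|^p+\frac1p-\frac1q$ and $E_*=V(0)=\frac1p-\frac1q$. For every such solution the energy $\frac1{p'}|w'|^p+V(w)$ is constant on $\mathbb R$, with a value $E\in[0,E_*)$. For every $E\in(0,E_*)$ there is a positive periodic solution of energy $E$, and all positive periodic solutions of energy $E$ have the same minimal period (least positive period), denoted by $T(E)$. The function $E\mapsto T(E)$ is (strictly) increasing on $(0,E_*)$, and $$\lim_{E\to0_+}T(E)=0,\qquad \lim_{E\to(E_*)_-}T(E)=+\infty.$$ -/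

import Mathlib

open Set Filter Topology

noncomputable section

namespace PLaplace

/-- The function `φ_r(s) = |s|^(r-2) s`. -/
def phi (r s : ℝ) : ℝ := |s| ^ (r - 2) * s

/-- `w : ℝ → ℝ` is a classical solution on the whole line of
`(φ_p(w'))' + φ_q(w) - φ_p(w) = 0`: both `w` and `φ_p(w')` are differentiable everywhere and the
equation holds at every point. (Continuity of `w'` and of `(φ_p(w'))'` then follows.) -/
def IsSolution (p q : ℝ) (w : ℝ → ℝ) : Prop :=
  Differentiable ℝ w ∧ Differentiable ℝ (fun t => phi p (deriv w t)) ∧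
    ∀ t, deriv (fun s => phi p (deriv w s)) t + phi q (w t) - phi p (w t) = 0

/-- A positive periodic solution (possibly constant). -/
def IsPositivePeriodicSolution (p q : ℝ) (w : ℝ → ℝ) : Prop :=
  IsSolution p q w ∧ (∀ t, 0 < w t) ∧ ∃ S, 0 < S ∧ Function.Periodic w S

/-- The potential `V(x) = |x|^q / q - |x|^p / p + 1/p - 1/q`. -/
def potential (p q x : ℝ) : ℝ := |x| ^ q / q - |x| ^ p / p + 1 / p - 1 / q

/-- The energy level `E_* = V(0)` of the homoclinic orbit. -/
def Estar (p q : ℝ) : ℝ := potential p q 0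

/-- `w` has energy `E`: the first integral `|w'|^p / p' + V(w)`, `p' = p / (p - 1)`,
is identically equal to `E`. -/
def HasEnergy (p q : ℝ) (w : ℝ → ℝ) (E : ℝ) : Prop :=
  ∀ t, 1 / Real.conjExponent p * |deriv w t| ^ p + potential p q (w t) = E

/-- `T` is the minimal period of `w`, i.e. the least of its positive periods. -/
def IsMinimalPeriod (w : ℝ → ℝ) (T : ℝ) : Prop :=
  IsLeast {S : ℝ | 0 < S ∧ Function.Periodic w S} T

/-- Sanity check: `E_* = 1/p - 1/q`. -/
theorem Estar_eq {p q : ℝ} (hp : 0 < p) (hq : 0 < q) : Estar p q = 1 / p - 1 / q := by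
  simp [Estar, potential, Real.zero_rpow hp.ne', Real.zero_rpow hq.ne']

end PLaplace

end

/-!
By conservation of energy, a positive periodic solution of energy `E` oscillates in the well of `V`
between `0` and the homoclinic maximum, and the time it takes from one turning point to the next,
which is half its period, is the integral of the reciprocal speed `(p' (E - V x)) ^ (-1 / p)`.
Conversely, inverting this time map and reflecting at the turning points gives a periodic solution.

In the coordinate `s` with `V x = E s ^ 2`, the period is
`2 p' ^ (-1 / p) E ^ (1 / 2 - 1 / p) ∫ s in (-1, 1), (1 - s ^ 2) ^ (-1 / p) X'(√E s)`, where `X` is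
the inverse of `x ↦ ± √(V x)`. Since `2 < p`, the power of `E` increases and tends to `0` with `E`.
The integral does not change when the odd term `4 k √E s` is added to `X'(√E s)`, and with
`k = V'''(1) / (6 V''(1) ^ 2)` Chicone's inequality `V V'' ≤ V' ^ 2 / 2 + k V' ^ 3` makes
`X'(s) + 4 k s` decreasing for `s < 0` and increasing for `s > 0`, so that the integral is
nondecreasing in `E`. Finally, `E - V x ≤ x ^ p / p` for `E ≤ E_*`, hence the reciprocal speed
dominates a multiple of `1 / x` and the period diverges logarithmically as `E` tends to `E_*`.
-/

namespace PLaplace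

open MeasureTheory

/-! ### Real analysis -/

lemma exists_isLeast_inter_Ioi {Z : Set ℝ} (hZ : IsClosed Z) {s : ℝ}
    (hs : ∀ᶠ t in 𝓝[>] s, t ∉ Z) (hne : (Z ∩ Ioi s).Nonempty) :
    ∃ t, IsLeast (Z ∩ Ioi s) t := by
  obtain ⟨u, hsu, hu⟩ := mem_nhdsGT_iff_exists_Ioo_subset.1 hs
  have hIci : Z ∩ Ioi s = Z ∩ Ici u := by
    ext t
    refine and_congr_right fun ht => ⟨fun hst => ?_, fun hut => (mem_Ioi.1 hsu).trans_le hut⟩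
    by_contra htu
    exact hu ⟨hst, not_le.1 htu⟩ ht
  rw [hIci] at hne ⊢
  exact ⟨_, (hZ.inter isClosed_Ici).isLeast_csInf hne ⟨u, fun _ ht => ht.2⟩⟩

lemma hasDerivAt_of_eventually_nhdsNE {f g : ℝ → ℝ} {x : ℝ}
    (h : ∀ᶠ y in 𝓝[≠] x, HasDerivAt f (g y) y) (hf : ContinuousAt f x) (hg : ContinuousAt g x) :
    HasDerivAt f (g x) x := by
  rw [← nhdsLT_sup_nhdsGT, eventually_sup] at h
  have hdiff : DifferentiableOn ℝ f {y | HasDerivAt f (g y) y} :=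
    fun y hy => hy.differentiableAt.differentiableWithinAt
  have hlim : ∀ l ≤ 𝓝 x, (∀ᶠ y in l, HasDerivAt f (g y) y) → Tendsto (deriv f) l (𝓝 (g x)) :=
    fun l hl hfg => (hg.tendsto.mono_left hl).congr' (hfg.mono fun y hy => hy.deriv.symm)
  have hr := hasDerivWithinAt_Ici_of_tendsto_deriv hdiff hf.continuousWithinAt h.2
    (hlim _ nhdsWithin_le_nhds h.2)
  have hl := hasDerivWithinAt_Iic_of_tendsto_deriv hdiff hf.continuousWithinAt h.1
    (hlim _ nhdsWithin_le_nhds h.1)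
  simpa using hl.union hr

lemma le_of_forall_hasDerivAt_of_mul_nonneg {f f' : ℝ → ℝ} {c x : ℝ}
    (hf : ∀ y ∈ uIcc c x, HasDerivAt f (f' y) y) (hf' : ∀ y ∈ uIcc c x, 0 ≤ (y - c) * f' y) :
    f c ≤ f x := by
  rcases lt_trichotomy c x with hcx | rfl | hxc
  · rw [uIcc_of_le hcx.le] at hf hf'
    obtain ⟨y, hy, hfy⟩ := exists_hasDerivAt_eq_slope f f' hcx
      (fun y hy => (hf y hy).continuousAt.continuousWithinAt)
      fun y hy => hf y (Ioo_subset_Icc_self hy)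
    have := nonneg_of_mul_nonneg_right (hf' y (Ioo_subset_Icc_self hy)) (sub_pos.2 hy.1)
    rw [hfy, le_div_iff₀ (sub_pos.2 hcx)] at this
    linarith
  · exact le_rfl
  · rw [uIcc_of_ge hxc.le] at hf hf'
    obtain ⟨y, hy, hfy⟩ := exists_hasDerivAt_eq_slope f f' hxc
      (fun y hy => (hf y hy).continuousAt.continuousWithinAt)
      fun y hy => hf y (Ioo_subset_Icc_self hy)
    have := nonpos_of_mul_nonneg_right (hf' y (Ioo_subset_Icc_self hy)) (sub_neg.2 hy.2)
    rw [hfy, div_le_iff₀ (sub_pos.2 hxc)] at this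
    linarith

lemma intervalIntegrable_of_integrable_sub_one {h : ℝ → ℝ} (hint : Integrable fun x => h x - 1)
    (c d : ℝ) : IntervalIntegrable h volume c d := by
  simpa using hint.intervalIntegrable.add (intervalIntegrable_const (c := (1 : ℝ)))

lemma surjective_primitive {h : ℝ → ℝ} (hint : Integrable fun x => h x - 1) (a : ℝ) :
    Function.Surjective fun x => ∫ y in a..x, h y := by
  have hI := intervalIntegrable_of_integrable_sub_one hint
  have hclose : ∀ x, |(∫ y in a..x, h y) - (x - a)| ≤ ∫ y, |h y - 1| := by
    intro x
    have : (∫ y in a..x, h y) - (x - a) = ∫ y in a..x, (h y - 1) := by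
      rw [intervalIntegral.integral_sub (hI a x) intervalIntegrable_const]
      simp
    rw [this]
    exact (intervalIntegral.norm_integral_le_integral_norm_uIoc).trans
      (setIntegral_le_integral hint.norm (Eventually.of_forall fun y => norm_nonneg _))
  refine (intervalIntegral.continuous_primitive hI a).surjective
    (tendsto_atTop_mono (f := fun x => x + (-a - ∫ y, |h y - 1|)) (fun x => ?_)
      (tendsto_atTop_add_const_right _ _ tendsto_id))
    (tendsto_atBot_mono (f := fun x => x + (-a + ∫ y, |h y - 1|)) (fun x => ?_)
      (tendsto_atBot_add_const_right _ _ tendsto_id))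
  · linarith [(abs_le.1 (hclose x)).1]
  · linarith [(abs_le.1 (hclose x)).2]

lemma exists_orderIso_primitive {h : ℝ → ℝ} (hint : Integrable fun x => h x - 1)
    (hpos : ∀ x, 0 < h x) (a : ℝ) : ∃ Θ : ℝ ≃o ℝ, ∀ x, Θ x = ∫ y in a..x, h y := by
  have hI := intervalIntegrable_of_integrable_sub_one hint
  have hmono : StrictMono fun x => ∫ y in a..x, h y := fun c d hcd => by
    have := intervalIntegral.intervalIntegral_pos_of_pos (hI c d) hpos hcd
    rw [← intervalIntegral.integral_interval_sub_left (hI a d) (hI a c)] at this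
    exact sub_pos.1 this
  exact ⟨hmono.orderIsoOfSurjective _ (surjective_primitive hint a), fun x => rfl⟩

lemma exists_orderIso_hasDerivAt {a b : ℝ} (hab : a ≤ b) {h : ℝ → ℝ}
    (hint : IntegrableOn h (Ioo a b)) (hpos : ∀ x ∈ Ioo a b, 0 < h x)
    (hcont : ContinuousOn h (Ioo a b)) :
    ∃ Θ : ℝ ≃o ℝ, Θ a = 0 ∧ Θ b = ∫ x in Ioo a b, h x ∧ ∀ x ∈ Ioo a b, HasDerivAt Θ (h x) x := by
  set g : ℝ → ℝ := fun x => (Ioo a b).indicator (fun y => h y - 1) x + 1 with hg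
  have hgh : EqOn g h (Ioo a b) := fun x hx => by simp [hg, hx]
  have hgint : Integrable fun x => g x - 1 := by
    simp only [hg, add_sub_cancel_right]
    exact (hint.sub (integrableOn_const (by simp))).integrable_indicator measurableSet_Ioo
  have hgpos : ∀ x, 0 < g x := fun x => by
    by_cases hx : x ∈ Ioo a b
    · rw [hgh hx]; exact hpos x hx
    · simp [hg, hx]
  obtain ⟨Θ, hΘ⟩ := exists_orderIso_primitive hgint hgpos a
  refine ⟨Θ, by simp [hΘ], ?_, fun x hx => ?_⟩
  · rw [hΘ, intervalIntegral.integral_of_le hab, integral_Ioc_eq_integral_Ioo]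
    exact setIntegral_congr_fun measurableSet_Ioo hgh
  · have hgcont : ContinuousOn g (Ioo a b) := hcont.congr hgh
    rw [← hgh hx, funext hΘ]
    exact intervalIntegral.integral_hasDerivAt_right
      (intervalIntegrable_of_integrable_sub_one hgint a x)
      (hgcont.stronglyMeasurableAtFilter isOpen_Ioo x hx)
      (hgcont.continuousAt (Ioo_mem_nhds hx.1 hx.2))

lemma integrableOn_mul_of_antitoneOn_of_monotoneOn {f g : ℝ → ℝ} {a b m A : ℝ}
    (hf : IntegrableOn f (Ioo a b)) (hanti : AntitoneOn g (Ico a m))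
    (hmono : MonotoneOn g (Ioc m b)) (hA : ∀ x ∈ Ioo a b, A ≤ g x) :
    IntegrableOn (fun x => f x * g x) (Ioo a b) := by
  have hcover : Ioo a b ⊆ Ico a m ∪ {m} ∪ Ioc m b := fun x hx => by
    rcases lt_trichotomy x m with h | h | h
    exacts [.inl (.inl ⟨hx.1.le, h⟩), .inl (.inr h), .inr ⟨h, hx.2.le⟩]
  have hmeas : AEMeasurable g (volume.restrict (Ioo a b)) := by
    refine AEMeasurable.mono_measure ?_ (Measure.restrict_mono_set volume hcover)
    refine aemeasurable_union_iff.2 ⟨aemeasurable_union_iff.2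
      ⟨aemeasurable_restrict_of_antitoneOn measurableSet_Ico hanti, ?_⟩,
      aemeasurable_restrict_of_monotoneOn measurableSet_Ioc hmono⟩
    rw [Measure.restrict_singleton, Real.volume_singleton, zero_smul]
    exact aemeasurable_zero_measure
  have hbound : ∀ x ∈ Ioo a b, |g x| ≤ max |A| (max |g a| (max |g m| |g b|)) := fun x hx => by
    have hlower : -|A| ≤ g x := (neg_abs_le A).trans (hA x hx)
    have hupper : g x ≤ max |g a| (max |g m| |g b|) := by
      rcases hcover hx with (h | rfl) | h
      · exact (hanti ⟨le_rfl, h.1.trans_lt h.2⟩ h h.1).trans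
          ((le_abs_self _).trans (le_max_left _ _))
      · exact (le_abs_self _).trans (by simp)
      · exact (hmono h ⟨h.1.trans_le h.2, le_rfl⟩ h.2).trans ((le_abs_self _).trans (by simp))
    exact abs_le.2 ⟨by linarith [le_max_left |A| (max |g a| (max |g m| |g b|))],
      hupper.trans (le_max_right _ _)⟩
  exact hf.mul_bdd hmeas.aestronglyMeasurable
    ((ae_restrict_iff' measurableSet_Ioo).2 (.of_forall hbound))

section

variable {p E : ℝ} {V F w : ℝ → ℝ}

/-! ### The odd power `φ_r` -/

lemma phi_of_nonneg {r x : ℝ} (hr : r ≠ 1) (hx : 0 ≤ x) : phi r x = x ^ (r - 1) := by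
  rcases hx.eq_or_lt with rfl | hx
  · simp [phi, Real.zero_rpow (sub_ne_zero.2 hr)]
  · rw [phi, abs_of_pos hx, show r - 1 = r - 2 + 1 by ring, Real.rpow_add_one hx.ne']

lemma abs_phi {r : ℝ} (hr : r ≠ 1) (x : ℝ) : |phi r x| = |x| ^ (r - 1) := by
  rw [← phi_of_nonneg hr (abs_nonneg x), phi, phi, abs_mul, abs_abs,
    abs_of_nonneg (Real.rpow_nonneg (abs_nonneg x) _)]

lemma phi_mul_sign (r v x : ℝ) : phi r (v * Real.sign x) = phi r v * Real.sign x := by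
  rcases Real.sign_apply_eq x with h | h | h <;> simp [phi, h]

lemma continuous_phi {r : ℝ} (hr : 1 < r) : Continuous (phi r) := by
  have hderiv : deriv (fun x : ℝ => |x| ^ r) = fun x => r * phi r x :=
    funext fun x => by rw [(hasDerivAt_abs_rpow x hr).deriv, phi, mul_assoc]
  have hcont : Continuous fun x => r * phi r x :=
    hderiv ▸ (contDiff_norm_rpow (E := ℝ) hr).continuous_deriv le_rfl
  simpa [(zero_lt_one.trans hr).ne'] using hcont.const_mul r⁻¹

lemma phi_conj_phi {r s : ℝ} (h : r.HolderConjugate s) (x : ℝ) : phi s (phi r x) = x := by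
  rcases eq_or_ne x 0 with rfl | hx
  · simp [phi]
  · have hexp : (r - 1) * (s - 2) + (r - 2) = 0 := by linear_combination h.mul_eq_add
    rw [phi, abs_phi h.lt.ne', phi, ← Real.rpow_mul (abs_nonneg x), ← mul_assoc,
      ← Real.rpow_add (abs_pos.2 hx), hexp, Real.rpow_zero, one_mul]

lemma abs_phi_rpow_conj {r s : ℝ} (h : r.HolderConjugate s) (x : ℝ) :
    |phi r x| ^ s = |x| ^ r := by
  rw [abs_phi h.lt.ne', ← Real.rpow_mul (abs_nonneg x), h.sub_one_mul_conj]

/-! ### Trajectories of `(φ_p(w'))' + V'(w) = 0` and the conservation of energy -/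

/-- `w` is a trajectory of energy `E` of the oscillator `(φ_p(w'))' + F(w) = 0`, where `F` stands
for the derivative of the potential `V`. -/
structure IsTrajectory (p : ℝ) (V F : ℝ → ℝ) (E : ℝ) (w : ℝ → ℝ) : Prop where
  differentiable : Differentiable ℝ w
  hasDerivAt_phi_deriv (t : ℝ) : HasDerivAt (fun s => phi p (deriv w s)) (-F (w t)) t
  energy_eq (t : ℝ) : 1 / p.conjExponent * |deriv w t| ^ p + V (w t) = E

lemma exists_isTrajectory (hp : 1 < p) (hw : Differentiable ℝ w)
    (hphi : ∀ t, HasDerivAt (fun s => phi p (deriv w s)) (-F (w t)) t)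
    (hV : ∀ t, HasDerivAt V (F (w t)) (w t)) : ∃ E, IsTrajectory p V F E w := by
  have hpp := Real.HolderConjugate.conjExponent hp
  have hkin : ∀ t, HasDerivAt (fun t => 1 / p.conjExponent * |deriv w t| ^ p)
      (-(F (w t) * deriv w t)) t := fun t => by
    simp_rw [← abs_phi_rpow_conj hpp]
    refine (((hasDerivAt_abs_rpow _ hpp.symm.lt).comp t (hphi t)).const_mul _).congr_deriv ?_
    have hinv := phi_conj_phi hpp (deriv w t)
    rw [phi] at hinv
    rw [mul_assoc p.conjExponent, hinv]
    field_simp [hpp.symm.ne_zero]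
  have henergy : ∀ t, HasDerivAt (fun t => 1 / p.conjExponent * |deriv w t| ^ p + V (w t)) 0 t :=
    fun t => ((hkin t).add ((hV t).comp t (hw t).hasDerivAt)).congr_deriv (neg_add_cancel _)
  exact ⟨_, hw, hphi, fun t => is_const_of_deriv_eq_zero
    (fun s => (henergy s).differentiableAt) (fun s => (henergy s).deriv) t 0⟩

/-- The reciprocal of the speed, at the point `x`, of a trajectory of energy `E`. -/
noncomputable def slowness (p : ℝ) (V : ℝ → ℝ) (E x : ℝ) : ℝ :=
  (p.conjExponent * (E - V x)) ^ (-(1 / p))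

lemma slowness_pos (hp : 1 < p) {x : ℝ} (hx : V x < E) : 0 < slowness p V E x :=
  Real.rpow_pos_of_pos (mul_pos (Real.HolderConjugate.conjExponent hp).symm.pos (sub_pos.2 hx)) _

namespace IsTrajectory

lemma abs_deriv_rpow (h : IsTrajectory p V F E w) (hp : 1 < p) (t : ℝ) :
    |deriv w t| ^ p = p.conjExponent * (E - V (w t)) := by
  have := (Real.HolderConjugate.conjExponent hp).symm.pos
  rw [← h.energy_eq t]
  field_simp
  ring

lemma potential_le (h : IsTrajectory p V F E w) (hp : 1 < p) (t : ℝ) : V (w t) ≤ E := by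
  have := h.abs_deriv_rpow hp t ▸ Real.rpow_nonneg (abs_nonneg (deriv w t)) p
  exact sub_nonneg.1 (nonneg_of_mul_nonneg_right this
    (Real.HolderConjugate.conjExponent hp).symm.pos)

lemma deriv_eq_zero_iff (h : IsTrajectory p V F E w) (hp : 1 < p) (t : ℝ) :
    deriv w t = 0 ↔ V (w t) = E := by
  rw [← abs_eq_zero, ← Real.rpow_eq_zero (abs_nonneg _) (zero_lt_one.trans hp).ne',
    h.abs_deriv_rpow hp, mul_eq_zero,
    or_iff_right (Real.HolderConjugate.conjExponent hp).symm.ne_zero, sub_eq_zero, eq_comm]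

lemma slowness_eq (h : IsTrajectory p V F E w) (hp : 1 < p) (t : ℝ) :
    slowness p V E (w t) = |deriv w t|⁻¹ := by
  rw [slowness, ← h.abs_deriv_rpow hp, ← Real.rpow_mul (abs_nonneg _), mul_neg,
    mul_one_div_cancel (zero_lt_one.trans hp).ne', Real.rpow_neg_one]

lemma exists_nonpos_of_periodic (h : IsTrajectory p V F E w) {S : ℝ} (hS : 0 < S)
    (hper : Function.Periodic w S) : ∃ t, F (w t) ≤ 0 := by
  by_contra! hpos
  have hanti : StrictAnti fun t => phi p (deriv w t) :=
    strictAnti_of_deriv_neg fun t => by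
      rw [(h.hasDerivAt_phi_deriv t).deriv]
      exact neg_neg_of_pos (hpos t)
  refine (hanti hS).ne ?_
  have hshift : (fun t => w (t + S)) = w := funext hper
  have hderiv : deriv w (0 + S) = deriv w 0 := by
    rw [← deriv_comp_add_const, hshift]
  simpa using congrArg (phi p) hderiv

lemma exists_isLeast_range (h : IsTrajectory p V F E w) {S : ℝ} (hS : 0 < S)
    (hper : Function.Periodic w S) : ∃ t, IsLeast (range w) (w t) ∧ deriv w t = 0 := by
  obtain ⟨x, hx⟩ := (hper.compact_of_continuous hS.ne'
    h.differentiable.continuous).exists_isLeast (range_nonempty w)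
  obtain ⟨t, rfl⟩ := hx.1
  exact ⟨t, hx, IsLocalMin.deriv_eq_zero (.of_forall fun s => hx.2 ⟨s, rfl⟩)⟩

end IsTrajectory

/-! ### The time map and the minimal period -/

/-- `[a, b]` is a well of the potential `V`, with derivative `F`, at the energy level `E`, and
neither of its end points is an equilibrium. -/
structure IsOscillationInterval (V F : ℝ → ℝ) (E a b : ℝ) : Prop where
  lt : a < b
  map_left : V a = E
  map_right : V b = E
  map_lt : ∀ x ∈ Ioo a b, V x < E
  hasDerivAt : ∀ x ∈ Icc a b, HasDerivAt V (F x) x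
  continuousOn : ContinuousOn F (Icc a b)
  left_ne_zero : F a ≠ 0
  right_ne_zero : F b ≠ 0

/-- On `[a, b]`, the function `Θ` is the time that a trajectory of energy `E` needs to travel from
`a` to a given point; it takes the time `τ` to reach `b`. Outside `[a, b]` only monotonicity
matters. -/
structure IsTimeMap (p : ℝ) (V : ℝ → ℝ) (E a b τ : ℝ) (Θ : ℝ ≃o ℝ) : Prop where
  map_left : Θ a = 0
  map_right : Θ b = τ
  hasDerivAt : ∀ x ∈ Ioo a b, HasDerivAt Θ (slowness p V E x) x

variable {a b τ : ℝ} {Θ : ℝ ≃o ℝ}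

lemma IsTimeMap.symm_zero (hΘ : IsTimeMap p V E a b τ Θ) : Θ.symm 0 = a :=
  Θ.symm_apply_eq.2 hΘ.map_left.symm

lemma IsTimeMap.symm_time (hΘ : IsTimeMap p V E a b τ Θ) : Θ.symm τ = b :=
  Θ.symm_apply_eq.2 hΘ.map_right.symm

namespace IsOscillationInterval

lemma map_le (J : IsOscillationInterval V F E a b) {x : ℝ} (hx : x ∈ Icc a b) : V x ≤ E := by
  rcases hx.1.eq_or_lt with rfl | hax
  · exact J.map_left.le
  rcases hx.2.eq_or_lt with rfl | hxb
  · exact J.map_right.le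
  exact (J.map_lt x ⟨hax, hxb⟩).le

lemma map_eq_iff (J : IsOscillationInterval V F E a b) {x : ℝ} (hx : x ∈ Icc a b) :
    V x = E ↔ x = a ∨ x = b := by
  refine ⟨fun h => ?_, ?_⟩
  · by_contra! hne
    exact (J.map_lt x ⟨hx.1.lt_of_ne' hne.1, hx.2.lt_of_ne hne.2⟩).ne h
  · rintro (rfl | rfl)
    exacts [J.map_left, J.map_right]

lemma continuousOn_slowness (J : IsOscillationInterval V F E a b) (hp : 1 < p) :
    ContinuousOn (slowness p V E) (Ioo a b) := fun x hx =>
  (((continuousAt_const.sub (J.hasDerivAt x (Ioo_subset_Icc_self hx)).continuousAt).const_mul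
    p.conjExponent).rpow_const (Or.inl (mul_pos
      (Real.HolderConjugate.conjExponent hp).symm.pos (sub_pos.2 (J.map_lt x hx))).ne')
    ).continuousWithinAt

lemma exists_isTimeMap (J : IsOscillationInterval V F E a b) (hp : 1 < p)
    (hint : IntegrableOn (slowness p V E) (Ioo a b)) :
    ∃ Θ, IsTimeMap p V E a b (∫ x in Ioo a b, slowness p V E x) Θ := by
  obtain ⟨Θ, ha, hb, hderiv⟩ := exists_orderIso_hasDerivAt J.lt.le hint
    (fun x hx => slowness_pos hp (J.map_lt x hx)) (J.continuousOn_slowness hp)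
  exact ⟨Θ, ha, hb, hderiv⟩

lemma time_pos (J : IsOscillationInterval V F E a b) (hΘ : IsTimeMap p V E a b τ Θ) : 0 < τ := by
  simpa only [hΘ.map_left, hΘ.map_right] using Θ.strictMono J.lt

end IsOscillationInterval

namespace IsTrajectory

lemma deriv_eq_zero_iff_turning (h : IsTrajectory p V F E w) (hp : 1 < p)
    (J : IsOscillationInterval V F E a b) (hwJ : ∀ t, w t ∈ Icc a b) (t : ℝ) :
    deriv w t = 0 ↔ w t = a ∨ w t = b := by
  rw [h.deriv_eq_zero_iff hp, J.map_eq_iff (hwJ t)]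

lemma eventually_deriv_ne_zero (h : IsTrajectory p V F E w) (hp : 1 < p)
    (J : IsOscillationInterval V F E a b) (hwJ : ∀ t, w t ∈ Icc a b) {s : ℝ}
    (hs : deriv w s = 0) : ∀ᶠ t in 𝓝[≠] s, deriv w t ≠ 0 := by
  have hF : F (w s) ≠ 0 := by
    rcases (h.deriv_eq_zero_iff_turning hp J hwJ s).1 hs with hs | hs <;> rw [hs]
    exacts [J.left_ne_zero, J.right_ne_zero]
  filter_upwards [(h.hasDerivAt_phi_deriv s).eventually_ne (c := 0) (neg_ne_zero.2 hF)]
    with t ht hzero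
  exact ht (by simp [hzero, phi])

lemma exists_next_turning (h : IsTrajectory p V F E w) (hp : 1 < p)
    (J : IsOscillationInterval V F E a b) (hwJ : ∀ t, w t ∈ Icc a b) {S : ℝ} (hS : 0 < S)
    (hper : Function.Periodic w S) {s : ℝ} (hs : deriv w s = 0) :
    ∃ t > s, deriv w t = 0 ∧ ∀ r ∈ Ioo s t, deriv w r ≠ 0 := by
  have hturn := h.deriv_eq_zero_iff_turning hp J hwJ
  have hclosed : IsClosed {t | deriv w t = 0} := by
    simp_rw [hturn]
    exact (isClosed_singleton.preimage h.differentiable.continuous).union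
      (isClosed_singleton.preimage h.differentiable.continuous)
  have hreturn : deriv w (s + S) = 0 := by rw [hturn, hper, ← hturn, hs]
  obtain ⟨t, ⟨ht, hst⟩, hleast⟩ := exists_isLeast_inter_Ioi hclosed
    ((h.eventually_deriv_ne_zero hp J hwJ hs).filter_mono (nhdsGT_le_nhdsNE s))
    ⟨s + S, hreturn, lt_add_of_pos_right s hS⟩
  exact ⟨t, hst, ht, fun r hr hr0 => (hleast ⟨hr0, hr.1⟩).not_gt hr.2⟩

lemma hasDerivAt_timeMap_comp (h : IsTrajectory p V F E w) (hp : 1 < p)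
    (J : IsOscillationInterval V F E a b) (hwJ : ∀ t, w t ∈ Icc a b)
    (hΘ : IsTimeMap p V E a b τ Θ) {t : ℝ} (ht : deriv w t ≠ 0) :
    HasDerivAt (fun t => Θ (w t)) (Real.sign (deriv w t)) t := by
  obtain ⟨ha, hb⟩ := not_or.1 (mt (h.deriv_eq_zero_iff_turning hp J hwJ t).2 ht)
  refine ((hΘ.hasDerivAt (w t) ⟨(hwJ t).1.lt_of_ne' ha, (hwJ t).2.lt_of_ne hb⟩).comp t
    (h.differentiable t).hasDerivAt).congr_deriv ?_
  rw [h.slowness_eq hp, inv_mul_eq_iff_eq_mul₀ (abs_ne_zero.2 ht)]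
  rcases lt_or_gt_of_ne ht with hneg | hpos
  · simp [abs_of_neg hneg, Real.sign_of_neg hneg]
  · simp [abs_of_pos hpos, Real.sign_of_pos hpos]

lemma exists_timeMap_comp_affine (h : IsTrajectory p V F E w) (hp : 1 < p)
    (J : IsOscillationInterval V F E a b) (hwJ : ∀ t, w t ∈ Icc a b)
    (hΘ : IsTimeMap p V E a b τ Θ) {s t : ℝ} (hne : ∀ r ∈ Ioo s t, deriv w r ≠ 0) :
    ∃ σ : ℝ, (σ = 1 ∨ σ = -1) ∧ ∀ r ∈ Icc s t, Θ (w r) = Θ (w s) + σ * (r - s) := by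
  obtain ⟨σ, hσ, hsign⟩ : ∃ σ : ℝ, (σ = 1 ∨ σ = -1) ∧
      ∀ r ∈ Ioo s t, Real.sign (deriv w r) = σ := by
    rcases hasDerivWithinAt_forall_lt_or_forall_gt_of_forall_ne (convex_Ioo s t)
      (fun r _ => (h.differentiable r).hasDerivAt.hasDerivWithinAt) hne with hneg | hpos
    · exact ⟨-1, Or.inr rfl, fun r hr => Real.sign_of_neg (hneg r hr)⟩
    · exact ⟨1, Or.inl rfl, fun r hr => Real.sign_of_pos (hpos r hr)⟩
  refine ⟨σ, hσ, fun r hr => ?_⟩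
  rcases hr.1.eq_or_lt with rfl | hsr
  · simp
  obtain ⟨c, hc, hslope⟩ := exists_hasDerivAt_eq_slope (fun r => Θ (w r)) _ hsr
    (Θ.continuous.comp h.differentiable.continuous).continuousOn
    fun y hy => h.hasDerivAt_timeMap_comp hp J hwJ hΘ (hne y ⟨hy.1, hy.2.trans_le hr.2⟩)
  rw [hsign c ⟨hc.1, hc.2.trans_le hr.2⟩, eq_div_iff (sub_pos.2 hsr).ne'] at hslope
  linarith

lemma timeMap_turning (h : IsTrajectory p V F E w) (hp : 1 < p)
    (J : IsOscillationInterval V F E a b) (hwJ : ∀ t, w t ∈ Icc a b)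
    (hΘ : IsTimeMap p V E a b τ Θ) (s : ℝ) :
    deriv w s = 0 ↔ Θ (w s) = 0 ∨ Θ (w s) = τ := by
  rw [h.deriv_eq_zero_iff_turning hp J hwJ, ← hΘ.map_left, ← hΘ.map_right, Θ.injective.eq_iff,
    Θ.injective.eq_iff]

lemma timeMap_add (h : IsTrajectory p V F E w) (hp : 1 < p)
    (J : IsOscillationInterval V F E a b) (hwJ : ∀ t, w t ∈ Icc a b)
    (hΘ : IsTimeMap p V E a b τ Θ) {S : ℝ} (hS : 0 < S) (hper : Function.Periodic w S) {s : ℝ}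
    (hs : deriv w s = 0) {r : ℝ} (hr : r ∈ Icc 0 τ) : Θ (w (s + r)) = |Θ (w s) - r| := by
  obtain ⟨t, hst, ht, hne⟩ := h.exists_next_turning hp J hwJ hS hper hs
  obtain ⟨σ, hσ, haffine⟩ := h.exists_timeMap_comp_affine hp J hwJ hΘ hne
  have hend := haffine t ⟨hst.le, le_rfl⟩
  have hmid : s + r ≤ t → Θ (w (s + r)) = Θ (w s) + σ * r := fun hle => by
    rw [haffine (s + r) ⟨by linarith [hr.1], hle⟩, add_sub_cancel_left]
  rw [h.timeMap_turning hp J hwJ hΘ] at hs ht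
  have hτ := J.time_pos hΘ
  rcases hσ with rfl | rfl <;> rcases hs with hs | hs <;> rcases ht with ht | ht <;>
    rw [hs, ht] at hend <;> try linarith
  · rw [hmid (by linarith [hr.2]), hs, zero_sub, abs_neg, abs_of_nonneg hr.1]
    ring
  · rw [hmid (by linarith [hr.2]), hs, abs_of_nonneg (sub_nonneg.2 hr.2)]
    ring

lemma timeMap_add_time (h : IsTrajectory p V F E w) (hp : 1 < p)
    (J : IsOscillationInterval V F E a b) (hwJ : ∀ t, w t ∈ Icc a b)
    (hΘ : IsTimeMap p V E a b τ Θ) {S : ℝ} (hS : 0 < S) (hper : Function.Periodic w S) {s : ℝ}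
    (hs : deriv w s = 0) : Θ (w (s + τ)) = τ - Θ (w s) ∧ deriv w (s + τ) = 0 := by
  have hτ := (J.time_pos hΘ).le
  have hadd := h.timeMap_add hp J hwJ hΘ hS hper hs ⟨hτ, le_rfl⟩
  rw [h.timeMap_turning hp J hwJ hΘ] at hs ⊢
  rcases hs with hs | hs <;> simp [hadd, hs, abs_of_nonneg hτ]

lemma exists_turning_mem_Icc (h : IsTrajectory p V F E w) (hp : 1 < p)
    (J : IsOscillationInterval V F E a b) (hwJ : ∀ t, w t ∈ Icc a b)
    (hΘ : IsTimeMap p V E a b τ Θ) {S : ℝ} (hS : 0 < S) (hper : Function.Periodic w S) (t : ℝ) :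
    ∃ s, deriv w s = 0 ∧ t - s ∈ Icc 0 τ := by
  have hτ := J.time_pos hΘ
  obtain ⟨s, hs, hs0⟩ := exists_deriv_eq_zero (f := w) (sub_lt_self t hS)
    h.differentiable.continuous.continuousOn (by simpa using (hper (t - S)).symm)
  have hturn : ∀ n : ℕ, deriv w (s + n * τ) = 0 := fun n => by
    induction n with
    | zero => simpa using hs0
    | succ n ih =>
      rw [Nat.cast_add_one, add_one_mul, ← add_assoc]
      exact (h.timeMap_add_time hp J hwJ hΘ hS hper ih).2
  have hnonneg : 0 ≤ (t - s) / τ := div_nonneg (sub_nonneg.2 hs.2.le) hτ.le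
  have hle := (le_div_iff₀ hτ).1 (Nat.floor_le hnonneg)
  have hlt := (div_lt_iff₀ hτ).1 (Nat.lt_floor_add_one ((t - s) / τ))
  exact ⟨_, hturn ⌊(t - s) / τ⌋₊, by linarith, by linarith⟩

lemma periodic_two_mul (h : IsTrajectory p V F E w) (hp : 1 < p)
    (J : IsOscillationInterval V F E a b) (hwJ : ∀ t, w t ∈ Icc a b)
    (hΘ : IsTimeMap p V E a b τ Θ) {S : ℝ} (hS : 0 < S) (hper : Function.Periodic w S) :
    Function.Periodic w (2 * τ) := by
  intro t
  obtain ⟨s, hs, hr⟩ := h.exists_turning_mem_Icc hp J hwJ hΘ hS hper t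
  obtain ⟨hΘ₁, hs₁⟩ := h.timeMap_add_time hp J hwJ hΘ hS hper hs
  obtain ⟨hΘ₂, hs₂⟩ := h.timeMap_add_time hp J hwJ hΘ hS hper hs₁
  have hadd₀ := h.timeMap_add hp J hwJ hΘ hS hper hs hr
  have hadd₂ := h.timeMap_add hp J hwJ hΘ hS hper hs₂ hr
  rw [hΘ₂, hΘ₁, sub_sub_cancel, ← hadd₀] at hadd₂
  convert Θ.injective hadd₂ using 2 <;> ring

lemma exists_eq_left (h : IsTrajectory p V F E w) (hp : 1 < p)
    (J : IsOscillationInterval V F E a b) (hwJ : ∀ t, w t ∈ Icc a b)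
    (hΘ : IsTimeMap p V E a b τ Θ) {S : ℝ} (hS : 0 < S) (hper : Function.Periodic w S) :
    ∃ s, deriv w s = 0 ∧ Θ (w s) = 0 := by
  obtain ⟨s, hs, -⟩ := h.exists_turning_mem_Icc hp J hwJ hΘ hS hper 0
  rcases (h.timeMap_turning hp J hwJ hΘ s).1 hs with hs0 | hsτ
  · exact ⟨s, hs, hs0⟩
  · obtain ⟨hΘ₁, hs₁⟩ := h.timeMap_add_time hp J hwJ hΘ hS hper hs
    exact ⟨s + τ, hs₁, by rw [hΘ₁, hsτ, sub_self]⟩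

theorem isMinimalPeriod (h : IsTrajectory p V F E w) (hp : 1 < p)
    (J : IsOscillationInterval V F E a b) (hwJ : ∀ t, w t ∈ Icc a b)
    (hΘ : IsTimeMap p V E a b τ Θ) (hper : ∃ S, 0 < S ∧ Function.Periodic w S) :
    IsMinimalPeriod w (2 * τ) := by
  obtain ⟨S₀, hS₀, hper₀⟩ := hper
  refine ⟨⟨mul_pos two_pos (J.time_pos hΘ), h.periodic_two_mul hp J hwJ hΘ hS₀ hper₀⟩, ?_⟩
  rintro S ⟨hS, hper⟩
  obtain ⟨s, hs, hs0⟩ := h.exists_eq_left hp J hwJ hΘ hS hper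
  obtain ⟨hΘ₁, hs₁⟩ := h.timeMap_add_time hp J hwJ hΘ hS hper hs
  have hreturn : Θ (w (s + S)) = 0 := by rw [hper, hs0]
  by_contra! hlt
  rcases le_or_gt S τ with hle | hgt
  · rw [h.timeMap_add hp J hwJ hΘ hS hper hs ⟨hS.le, hle⟩, hs0, abs_eq_zero] at hreturn
    linarith
  · have hadd := h.timeMap_add hp J hwJ hΘ hS hper hs₁ (r := S - τ) ⟨by linarith, by linarith⟩
    rw [add_add_sub_cancel, hreturn, hΘ₁, hs0, eq_comm, abs_eq_zero] at hadd
    linarith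

end IsTrajectory

end

section

variable {p E : ℝ} {V F : ℝ → ℝ} {a b τ : ℝ} {Θ : ℝ ≃o ℝ}

/-! ### Existence of periodic trajectories -/

lemma eventually_sign_eq {f : ℝ → ℝ} {t : ℝ} (hf : ContinuousAt f t) (ht : f t ≠ 0) :
    ∀ᶠ s in 𝓝 t, Real.sign (f s) = Real.sign (f t) := by
  rcases lt_or_gt_of_ne ht with hneg | hpos
  · filter_upwards [hf.eventually_lt_const hneg] with s hs
    rw [Real.sign_of_neg hs, Real.sign_of_neg hneg]
  · filter_upwards [hf.eventually_const_lt hpos] with s hs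
    rw [Real.sign_of_pos hs, Real.sign_of_pos hpos]

/-- The even continuous function of period `2τ` that is the identity on `[0, τ]`. -/
noncomputable def triangleWave (τ t : ℝ) : ℝ :=
  τ / Real.pi * Real.arccos (Real.cos (Real.pi / τ * t))

lemma continuous_triangleWave (τ : ℝ) : Continuous (triangleWave τ) :=
  continuous_const.mul (Real.continuous_arccos.comp (by fun_prop))

lemma periodic_triangleWave (hτ : τ ≠ 0) : Function.Periodic (triangleWave τ) (2 * τ) := by
  intro t
  have hshift : Real.pi / τ * (t + 2 * τ) = Real.pi / τ * t + 2 * Real.pi := by field_simp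
  rw [triangleWave, triangleWave, hshift, Real.cos_add_two_pi]

lemma triangleWave_mem_Icc (hτ : 0 ≤ τ) (t : ℝ) : triangleWave τ t ∈ Icc 0 τ := by
  have hπ := Real.pi_pos
  refine ⟨mul_nonneg (div_nonneg hτ hπ.le) (Real.arccos_nonneg _), ?_⟩
  rw [triangleWave, div_mul_eq_mul_div, div_le_iff₀ hπ]
  exact mul_le_mul_of_nonneg_left (Real.arccos_le_pi _) hτ

lemma triangleWave_mem_Ioo_iff (hτ : 0 < τ) {t : ℝ} :
    triangleWave τ t ∈ Ioo 0 τ ↔ Real.sin (Real.pi / τ * t) ≠ 0 := by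
  have hπ := Real.pi_pos
  rw [Ne, Real.sin_eq_zero_iff_cos_eq, not_or, mem_Ioo, triangleWave]
  have hle := Real.cos_le_one (Real.pi / τ * t)
  have hge := Real.neg_one_le_cos (Real.pi / τ * t)
  generalize Real.cos (Real.pi / τ * t) = c at hle hge ⊢
  rw [mul_pos_iff_of_pos_left (div_pos hτ hπ), Real.arccos_pos, div_mul_eq_mul_div, div_lt_iff₀ hπ,
    mul_lt_mul_iff_right₀ hτ, (Real.arccos_le_pi c).lt_iff_ne, Ne, Real.arccos_eq_pi,
    hle.lt_iff_ne, hge.ge_iff_eq']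

lemma hasDerivAt_triangleWave (hτ : τ ≠ 0) {t : ℝ} (ht : Real.sin (Real.pi / τ * t) ≠ 0) :
    HasDerivAt (triangleWave τ) (Real.sign (Real.sin (Real.pi / τ * t))) t := by
  obtain ⟨h₁, h₂⟩ := not_or.1 (mt Real.sin_eq_zero_iff_cos_eq.2 ht)
  refine (((Real.hasDerivAt_arccos h₂ h₁).comp t
    ((hasDerivAt_const_mul (Real.pi / τ)).cos)).const_mul (τ / Real.pi)).congr_deriv ?_
  rw [← Real.sin_sq, Real.sqrt_sq_eq_abs]
  generalize Real.sin (Real.pi / τ * t) = s at ht ⊢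
  have hπ := Real.pi_ne_zero
  rcases lt_or_gt_of_ne ht with h | h
  · rw [abs_of_neg h, Real.sign_of_neg h]
    field_simp
  · rw [abs_of_pos h, Real.sign_of_pos h]
    field_simp

lemma eventually_sin_ne_zero (hτ : τ ≠ 0) (t : ℝ) :
    ∀ᶠ s in 𝓝[≠] t, Real.sin (Real.pi / τ * s) ≠ 0 := by
  by_cases ht : Real.sin (Real.pi / τ * t) = 0
  · refine (hasDerivAt_const_mul (Real.pi / τ)).sin.eventually_ne
      (mul_ne_zero (fun hcos => ?_) (div_ne_zero Real.pi_ne_zero hτ))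
    rcases Real.sin_eq_zero_iff_cos_eq.1 ht with h | h <;> simp [h] at hcos
  · have hcont : ContinuousAt (fun s => Real.sin (Real.pi / τ * s)) t := by fun_prop
    exact (hcont.eventually_ne ht).filter_mono nhdsWithin_le_nhds

/-- The back and forth motion whose time map is `Θ`. -/
noncomputable def orbit (Θ : ℝ ≃o ℝ) (τ t : ℝ) : ℝ := Θ.symm (triangleWave τ t)

/-- The velocity of `orbit Θ τ` prescribed by the energy `E`. -/
noncomputable def orbitVelocity (p : ℝ) (V : ℝ → ℝ) (E : ℝ) (Θ : ℝ ≃o ℝ) (τ t : ℝ) : ℝ :=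
  (p.conjExponent * (E - V (orbit Θ τ t))) ^ (1 / p) * Real.sign (Real.sin (Real.pi / τ * t))

lemma continuous_orbit (Θ : ℝ ≃o ℝ) (τ : ℝ) : Continuous (orbit Θ τ) :=
  Θ.symm.continuous.comp (continuous_triangleWave τ)

lemma periodic_orbit (hτ : τ ≠ 0) : Function.Periodic (orbit Θ τ) (2 * τ) := fun t => by
  rw [orbit, orbit, periodic_triangleWave hτ]

lemma orbitVelocity_eq_zero {t : ℝ} (ht : Real.sin (Real.pi / τ * t) = 0) :
    orbitVelocity p V E Θ τ t = 0 := by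
  rw [orbitVelocity, ht, Real.sign_zero, mul_zero]

namespace IsOscillationInterval

variable (J : IsOscillationInterval V F E a b) (hΘ : IsTimeMap p V E a b τ Θ)
include J hΘ

lemma orbit_mem_Icc (t : ℝ) : orbit Θ τ t ∈ Icc a b := by
  have h := triangleWave_mem_Icc (J.time_pos hΘ).le t
  rw [← hΘ.symm_zero, ← hΘ.symm_time]
  exact ⟨Θ.symm.monotone h.1, Θ.symm.monotone h.2⟩

lemma orbit_mem_Ioo_iff (t : ℝ) :
    orbit Θ τ t ∈ Ioo a b ↔ Real.sin (Real.pi / τ * t) ≠ 0 := by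
  rw [← triangleWave_mem_Ioo_iff (J.time_pos hΘ), ← hΘ.symm_zero, ← hΘ.symm_time, orbit, mem_Ioo,
    Θ.symm.lt_iff_lt, Θ.symm.lt_iff_lt, mem_Ioo]

lemma potential_orbit_lt {t : ℝ} (ht : Real.sin (Real.pi / τ * t) ≠ 0) : V (orbit Θ τ t) < E :=
  J.map_lt _ ((J.orbit_mem_Ioo_iff hΘ t).2 ht)

lemma potential_orbit_eq {t : ℝ} (ht : Real.sin (Real.pi / τ * t) = 0) : V (orbit Θ τ t) = E := by
  have hmem := J.orbit_mem_Icc hΘ t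
  by_contra hne
  obtain ⟨ha, hb⟩ := not_or.1 (mt (J.map_eq_iff hmem).2 hne)
  exact (J.orbit_mem_Ioo_iff hΘ t).1 ⟨hmem.1.lt_of_ne' ha, hmem.2.lt_of_ne hb⟩ ht

lemma continuous_potential_orbit : Continuous fun t => V (orbit Θ τ t) :=
  continuous_iff_continuousAt.2 fun t =>
    (J.hasDerivAt _ (J.orbit_mem_Icc hΘ t)).continuousAt.comp (continuous_orbit Θ τ).continuousAt

lemma continuous_orbitVelocity (hp : 1 < p) : Continuous (orbitVelocity p V E Θ τ) := by
  have hspeed : Continuous fun t => (p.conjExponent * (E - V (orbit Θ τ t))) ^ (1 / p) :=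
    (continuous_const.mul (continuous_const.sub (J.continuous_potential_orbit hΘ))).rpow_const
      fun _ => Or.inr (one_div_nonneg.2 (zero_lt_one.trans hp).le)
  refine continuous_iff_continuousAt.2 fun t => ?_
  by_cases ht : Real.sin (Real.pi / τ * t) = 0
  · have hzero : (p.conjExponent * (E - V (orbit Θ τ t))) ^ (1 / p) = 0 := by
      rw [J.potential_orbit_eq hΘ ht, sub_self, mul_zero,
        Real.zero_rpow (one_div_ne_zero (zero_lt_one.trans hp).ne')]
    have hlim := hspeed.abs.tendsto t
    rw [hzero, abs_zero] at hlim
    rw [ContinuousAt, orbitVelocity, hzero, zero_mul]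
    refine squeeze_zero_norm (fun s => ?_) hlim
    rw [orbitVelocity, norm_mul, Real.norm_eq_abs]
    refine mul_le_of_le_one_right (abs_nonneg _) ?_
    rcases Real.sign_apply_eq (Real.sin (Real.pi / τ * s)) with h | h | h <;> simp [h]
  · exact hspeed.continuousAt.mul (continuousAt_const.congr
      ((eventually_sign_eq (f := fun s => Real.sin (Real.pi / τ * s)) (by fun_prop) ht).mono
        fun s hs => hs.symm))

lemma hasDerivAt_orbit (hp : 1 < p) (t : ℝ) :
    HasDerivAt (orbit Θ τ) (orbitVelocity p V E Θ τ t) t := by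
  refine hasDerivAt_of_eventually_nhdsNE ?_ (continuous_orbit Θ τ).continuousAt
    (J.continuous_orbitVelocity hΘ hp).continuousAt
  filter_upwards [eventually_sin_ne_zero (J.time_pos hΘ).ne' t] with s hs
  have hlt := J.potential_orbit_lt hΘ hs
  have hsymm : HasDerivAt Θ.symm (slowness p V E (orbit Θ τ s))⁻¹ (triangleWave τ s) :=
    HasDerivAt.of_local_left_inverse Θ.symm.continuous.continuousAt
      (hΘ.hasDerivAt _ ((J.orbit_mem_Ioo_iff hΘ s).2 hs)) (slowness_pos hp hlt).ne'
      (.of_forall Θ.apply_symm_apply)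
  refine (hsymm.comp s (hasDerivAt_triangleWave (J.time_pos hΘ).ne' hs)).congr_deriv ?_
  rw [slowness, Real.rpow_neg, inv_inv, orbitVelocity]
  exact mul_nonneg (Real.HolderConjugate.conjExponent hp).symm.nonneg (sub_nonneg.2 hlt.le)

lemma phi_orbitVelocity (hp : 1 < p) (t : ℝ) : phi p (orbitVelocity p V E Θ τ t) =
    (p.conjExponent * (E - V (orbit Θ τ t))) ^ (1 / p.conjExponent) *
      Real.sign (Real.sin (Real.pi / τ * t)) := by
  have hpp := Real.HolderConjugate.conjExponent hp
  have hnonneg : 0 ≤ p.conjExponent * (E - V (orbit Θ τ t)) :=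
    mul_nonneg hpp.symm.nonneg (sub_nonneg.2 (J.map_le (J.orbit_mem_Icc hΘ t)))
  have hexp : 1 / p * (p - 1) = 1 / p.conjExponent := by
    rw [one_div p.conjExponent, ← hpp.one_sub_inv]
    field_simp [hpp.ne_zero]
  rw [orbitVelocity, phi_mul_sign, phi_of_nonneg hp.ne' (Real.rpow_nonneg hnonneg _),
    ← Real.rpow_mul hnonneg, hexp]

lemma hasDerivAt_phi_orbitVelocity (hp : 1 < p) (t : ℝ) :
    HasDerivAt (fun s => phi p (orbitVelocity p V E Θ τ s)) (-F (orbit Θ τ t)) t := by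
  have hpp := Real.HolderConjugate.conjExponent hp
  refine hasDerivAt_of_eventually_nhdsNE (g := fun t => -F (orbit Θ τ t)) ?_
    ((continuous_phi hp).comp (J.continuous_orbitVelocity hΘ hp)).continuousAt
    (J.continuousOn.comp_continuous (continuous_orbit Θ τ) (J.orbit_mem_Icc hΘ)).neg.continuousAt
  filter_upwards [eventually_sin_ne_zero (J.time_pos hΘ).ne' t] with s hs
  simp_rw [J.phi_orbitVelocity hΘ hp]
  set y := p.conjExponent * (E - V (orbit Θ τ s))
  set σ := Real.sign (Real.sin (Real.pi / τ * s)) with hσ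
  have hypos : 0 < y := mul_pos hpp.symm.pos (sub_pos.2 (J.potential_orbit_lt hΘ hs))
  have hV := (J.hasDerivAt _ (J.orbit_mem_Icc hΘ s)).comp s (J.hasDerivAt_orbit hΘ hp s)
  refine HasDerivAt.congr_deriv ((((hV.const_sub E).const_mul p.conjExponent).rpow_const
    (p := 1 / p.conjExponent) (Or.inl hypos.ne')).mul_const σ |>.congr_of_eventuallyEq ?_) ?_
  · filter_upwards [eventually_sign_eq (f := fun r => Real.sin (Real.pi / τ * r))
      (by fun_prop) hs] with r hr
    rw [hr]
    rfl
  · have hσσ : σ * σ = 1 := by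
      rcases Real.sign_apply_eq_of_ne_zero _ hs with h | h <;> rw [hσ, h] <;> norm_num
    have hexp : 1 / p.conjExponent - 1 = -(1 / p) := by
      rw [one_div, one_div, hpp.symm.inv_sub_one]
    have hcancel : y ^ (1 / p) * y ^ (-(1 / p)) = 1 := by
      rw [← Real.rpow_add hypos, add_neg_cancel, Real.rpow_zero]
    have hconj := mul_one_div_cancel hpp.symm.ne_zero
    rw [hexp, orbitVelocity]
    change p.conjExponent * -(F (orbit Θ τ s) * (y ^ (1 / p) * σ)) * (1 / p.conjExponent) *
      y ^ (-(1 / p)) * σ = -F (orbit Θ τ s)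
    calc _ = -F (orbit Θ τ s) * (p.conjExponent * (1 / p.conjExponent)) *
          (y ^ (1 / p) * y ^ (-(1 / p))) * (σ * σ) := by ring
      _ = _ := by rw [hconj, hcancel, hσσ, mul_one, mul_one, mul_one]

lemma energy_orbit (hp : 1 < p) (t : ℝ) :
    1 / p.conjExponent * |orbitVelocity p V E Θ τ t| ^ p + V (orbit Θ τ t) = E := by
  have hpp := Real.HolderConjugate.conjExponent hp
  have hpow : |orbitVelocity p V E Θ τ t| ^ p = p.conjExponent * (E - V (orbit Θ τ t)) := by
    by_cases ht : Real.sin (Real.pi / τ * t) = 0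
    · rw [orbitVelocity_eq_zero ht, J.potential_orbit_eq hΘ ht, abs_zero,
        Real.zero_rpow hpp.ne_zero, sub_self, mul_zero]
    · have hnonneg : 0 ≤ p.conjExponent * (E - V (orbit Θ τ t)) :=
        mul_nonneg hpp.symm.nonneg (sub_nonneg.2 (J.potential_orbit_lt hΘ ht).le)
      have habs : |Real.sign (Real.sin (Real.pi / τ * t))| = 1 := by
        rcases Real.sign_apply_eq_of_ne_zero _ ht with h | h <;> simp [h]
      rw [orbitVelocity, abs_mul, habs, mul_one, abs_of_nonneg (Real.rpow_nonneg hnonneg _),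
        ← Real.rpow_mul hnonneg, one_div_mul_cancel hpp.ne_zero, Real.rpow_one]
  rw [hpow]
  field_simp [hpp.symm.ne_zero]
  ring

theorem isTrajectory_orbit (hp : 1 < p) : IsTrajectory p V F E (orbit Θ τ) := by
  have hderiv : deriv (orbit Θ τ) = orbitVelocity p V E Θ τ :=
    funext fun t => (J.hasDerivAt_orbit hΘ hp t).deriv
  refine ⟨fun t => (J.hasDerivAt_orbit hΘ hp t).differentiableAt, ?_, ?_⟩ <;> rw [hderiv]
  exacts [J.hasDerivAt_phi_orbitVelocity hΘ hp, J.energy_orbit hΘ hp]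

end IsOscillationInterval

end

section

variable {E : ℝ} {V F : ℝ → ℝ} {l c r : ℝ}

/-! ### Potential wells -/

/-- On `[l, r]` the potential `V`, with derivative `F`, is a well of depth `V l = V r` whose only
equilibrium is the bottom `c`, at which `V` vanishes. -/
structure IsPotentialWell (V F : ℝ → ℝ) (l c r : ℝ) : Prop where
  mem : c ∈ Ioo l r
  map_bottom : V c = 0
  map_right : V r = V l
  continuousOn : ContinuousOn V (Icc l r)
  hasDerivAt : ∀ x ∈ Ioo l r, HasDerivAt V (F x) x
  continuousOn_deriv : ContinuousOn F (Ioo l r)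
  neg_of_lt : ∀ x ∈ Ioo l c, F x < 0
  pos_of_gt : ∀ x ∈ Ioo c r, 0 < F x

/-- The coordinate `s` in which the potential `V` with bottom `c` is harmonic: `V x = s ^ 2`, with
the sign of `x - c`. -/
noncomputable def signedRoot (V : ℝ → ℝ) (c x : ℝ) : ℝ := √(V (max x c)) - √(V (min x c))

/-- The inverse of `signedRoot V c` on `(l, r)`. -/
noncomputable def position (V : ℝ → ℝ) (l c r s : ℝ) : ℝ :=
  Function.invFunOn (signedRoot V c) (Ioo l r) s

/-- The derivative of `position` with respect to `s`, except that the value at `s = 0` is `0`. -/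
noncomputable def positionDeriv (V F : ℝ → ℝ) (l c r s : ℝ) : ℝ := 2 * s / F (position V l c r s)

namespace IsPotentialWell

lemma strictAntiOn (W : IsPotentialWell V F l c r) : StrictAntiOn V (Icc l c) := by
  refine strictAntiOn_of_deriv_neg (convex_Icc l c)
    (W.continuousOn.mono (Icc_subset_Icc_right W.mem.2.le)) fun x hx => ?_
  rw [interior_Icc] at hx
  rw [(W.hasDerivAt x ⟨hx.1, hx.2.trans W.mem.2⟩).deriv]
  exact W.neg_of_lt x hx

lemma strictMonoOn (W : IsPotentialWell V F l c r) : StrictMonoOn V (Icc c r) := by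
  refine strictMonoOn_of_deriv_pos (convex_Icc c r)
    (W.continuousOn.mono (Icc_subset_Icc_left W.mem.1.le)) fun x hx => ?_
  rw [interior_Icc] at hx
  rw [(W.hasDerivAt x ⟨W.mem.1.trans hx.1, hx.2⟩).deriv]
  exact W.pos_of_gt x hx

lemma map_pos (W : IsPotentialWell V F l c r) {x : ℝ} (hx : x ∈ Icc l r) (hne : x ≠ c) :
    0 < V x := by
  rw [← W.map_bottom]
  rcases lt_or_gt_of_ne hne with hlt | hgt
  · exact W.strictAntiOn ⟨hx.1, hlt.le⟩ ⟨W.mem.1.le, le_rfl⟩ hlt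
  · exact W.strictMonoOn ⟨le_rfl, W.mem.2.le⟩ ⟨hgt.le, hx.2⟩ hgt

lemma map_nonneg (W : IsPotentialWell V F l c r) {x : ℝ} (hx : x ∈ Icc l r) : 0 ≤ V x := by
  rcases eq_or_ne x c with rfl | hne
  · exact W.map_bottom.ge
  · exact (W.map_pos hx hne).le

lemma depth_pos (W : IsPotentialWell V F l c r) : 0 < V l :=
  W.map_pos ⟨le_rfl, (W.mem.1.trans W.mem.2).le⟩ W.mem.1.ne

lemma signedRoot_of_le (W : IsPotentialWell V F l c r) {x : ℝ} (hx : x ≤ c) :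
    signedRoot V c x = -√(V x) := by
  rw [signedRoot, max_eq_right hx, min_eq_left hx, W.map_bottom, Real.sqrt_zero, zero_sub]

lemma signedRoot_of_ge (W : IsPotentialWell V F l c r) {x : ℝ} (hx : c ≤ x) :
    signedRoot V c x = √(V x) := by
  rw [signedRoot, max_eq_left hx, min_eq_right hx, W.map_bottom, Real.sqrt_zero, sub_zero]

lemma signedRoot_sq (W : IsPotentialWell V F l c r) {x : ℝ} (hx : x ∈ Icc l r) :
    signedRoot V c x ^ 2 = V x := by
  rcases le_total x c with h | h
  · rw [W.signedRoot_of_le h, neg_sq, Real.sq_sqrt (W.map_nonneg hx)]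
  · rw [W.signedRoot_of_ge h, Real.sq_sqrt (W.map_nonneg hx)]

lemma strictMonoOn_signedRoot (W : IsPotentialWell V F l c r) :
    StrictMonoOn (signedRoot V c) (Icc l r) := by
  rw [← Icc_union_Icc_eq_Icc W.mem.1.le W.mem.2.le]
  refine StrictMonoOn.union (c := c) (fun x hx y hy hxy => ?_) (fun x hx y hy hxy => ?_)
    (isGreatest_Icc W.mem.1.le) (isLeast_Icc W.mem.2.le)
  · rw [W.signedRoot_of_le hx.2, W.signedRoot_of_le hy.2, neg_lt_neg_iff]
    exact Real.sqrt_lt_sqrt (W.map_nonneg ⟨hy.1, hy.2.trans W.mem.2.le⟩) (W.strictAntiOn hx hy hxy)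
  · rw [W.signedRoot_of_ge hx.1, W.signedRoot_of_ge hy.1]
    exact Real.sqrt_lt_sqrt (W.map_nonneg ⟨W.mem.1.le.trans hx.1, hx.2⟩) (W.strictMonoOn hx hy hxy)

lemma continuousOn_signedRoot (W : IsPotentialWell V F l c r) :
    ContinuousOn (signedRoot V c) (Icc l r) :=
  ((W.continuousOn.comp (by fun_prop) fun _ hx =>
      ⟨le_max_of_le_left hx.1, max_le hx.2 W.mem.2.le⟩).sqrt).sub
    (W.continuousOn.comp (by fun_prop) fun _ hx =>
      ⟨le_min hx.1 W.mem.1.le, min_le_of_left_le hx.2⟩).sqrt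

lemma bijOn_signedRoot (W : IsPotentialWell V F l c r) :
    BijOn (signedRoot V c) (Ioo l r) (Ioo (-√(V l)) √(V l)) := by
  refine ⟨?_, W.strictMonoOn_signedRoot.injOn.mono Ioo_subset_Icc_self, ?_⟩
  all_goals
    rw [← W.signedRoot_of_le W.mem.1.le, ← W.map_right, ← W.signedRoot_of_ge W.mem.2.le]
  · exact W.strictMonoOn_signedRoot.mapsTo_Ioo
  · exact intermediate_value_Ioo (W.mem.1.trans W.mem.2).le W.continuousOn_signedRoot

lemma position_mem (W : IsPotentialWell V F l c r) {s : ℝ} (hs : s ∈ Ioo (-√(V l)) √(V l)) :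
    position V l c r s ∈ Ioo l r :=
  W.bijOn_signedRoot.surjOn.mapsTo_invFunOn hs

lemma signedRoot_position (W : IsPotentialWell V F l c r) {s : ℝ}
    (hs : s ∈ Ioo (-√(V l)) √(V l)) : signedRoot V c (position V l c r s) = s :=
  W.bijOn_signedRoot.invOn_invFunOn.2 hs

lemma position_signedRoot (W : IsPotentialWell V F l c r) {x : ℝ} (hx : x ∈ Ioo l r) :
    position V l c r (signedRoot V c x) = x :=
  W.bijOn_signedRoot.invOn_invFunOn.1 hx

lemma position_lt_iff (W : IsPotentialWell V F l c r) {s : ℝ} (hs : s ∈ Ioo (-√(V l)) √(V l))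
    {x : ℝ} (hx : x ∈ Icc l r) : position V l c r s < x ↔ s < signedRoot V c x := by
  rw [← W.strictMonoOn_signedRoot.lt_iff_lt (Ioo_subset_Icc_self (W.position_mem hs)) hx,
    W.signedRoot_position hs]

lemma lt_position_iff (W : IsPotentialWell V F l c r) {s : ℝ} (hs : s ∈ Ioo (-√(V l)) √(V l))
    {x : ℝ} (hx : x ∈ Icc l r) : x < position V l c r s ↔ signedRoot V c x < s := by
  rw [← W.strictMonoOn_signedRoot.lt_iff_lt hx (Ioo_subset_Icc_self (W.position_mem hs)),
    W.signedRoot_position hs]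

lemma monotoneOn_position (W : IsPotentialWell V F l c r) :
    MonotoneOn (position V l c r) (Ioo (-√(V l)) √(V l)) := fun s hs t ht hst => by
  rwa [← not_lt, W.position_lt_iff ht (Ioo_subset_Icc_self (W.position_mem hs)),
    W.signedRoot_position hs, not_lt]

lemma signedRoot_bottom (W : IsPotentialWell V F l c r) : signedRoot V c c = 0 := by
  rw [W.signedRoot_of_ge le_rfl, W.map_bottom, Real.sqrt_zero]

lemma positionDeriv_pos (W : IsPotentialWell V F l c r) {s : ℝ}
    (hs : s ∈ Ioo (-√(V l)) √(V l)) (hne : s ≠ 0) : 0 < positionDeriv V F l c r s := by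
  have hmem := W.position_mem hs
  have hc := Ioo_subset_Icc_self W.mem
  rw [← W.signedRoot_bottom] at hne
  rcases lt_or_gt_of_ne hne with hlt | hgt
  · have hF := W.neg_of_lt _ ⟨hmem.1, (W.position_lt_iff hs hc).2 hlt⟩
    rw [W.signedRoot_bottom] at hlt
    exact div_pos_of_neg_of_neg (by linarith) hF
  · have hF := W.pos_of_gt _ ⟨(W.lt_position_iff hs hc).2 hgt, hmem.2⟩
    rw [W.signedRoot_bottom] at hgt
    exact div_pos (by linarith) hF

lemma hasDerivAt_signedRoot (W : IsPotentialWell V F l c r) {x : ℝ} (hx : x ∈ Ioo l r)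
    (hne : x ≠ c) :
    HasDerivAt (signedRoot V c) (positionDeriv V F l c r (signedRoot V c x))⁻¹ x := by
  rw [positionDeriv, W.position_signedRoot hx, inv_div]
  have hsqrt := (W.hasDerivAt x hx).sqrt (W.map_pos (Ioo_subset_Icc_self hx) hne).ne'
  rcases lt_or_gt_of_ne hne with hlt | hgt
  · rw [W.signedRoot_of_le hlt.le, mul_neg, div_neg]
    refine hsqrt.neg.congr_of_eventuallyEq ?_
    filter_upwards [Iio_mem_nhds hlt] with y hy using W.signedRoot_of_le hy.le
  · rw [W.signedRoot_of_ge hgt.le]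
    refine hsqrt.congr_of_eventuallyEq ?_
    filter_upwards [Ioi_mem_nhds hgt] with y hy using W.signedRoot_of_ge hy.le

lemma sqrt_mem (W : IsPotentialWell V F l c r) (hE : E ∈ Ioo 0 (V l)) :
    √E ∈ Ioo (-√(V l)) √(V l) :=
  ⟨by linarith [Real.sqrt_nonneg E, Real.sqrt_pos.2 W.depth_pos],
    Real.sqrt_lt_sqrt hE.1.le hE.2⟩

lemma neg_sqrt_mem (W : IsPotentialWell V F l c r) (hE : E ∈ Ioo 0 (V l)) :
    -√E ∈ Ioo (-√(V l)) √(V l) :=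
  ⟨neg_lt_neg (W.sqrt_mem hE).2, neg_lt.1 (W.sqrt_mem hE).1⟩

lemma sublevel_eq_Ioo (W : IsPotentialWell V F l c r) (hE : E ∈ Ioo 0 (V l)) :
    {x ∈ Ioo l r | V x < E} = Ioo (position V l c r (-√E)) (position V l c r √E) := by
  ext x
  constructor
  · rintro ⟨hx, hlt⟩
    rw [← W.signedRoot_sq (Ioo_subset_Icc_self hx), Real.sq_lt] at hlt
    exact ⟨(W.position_lt_iff (W.neg_sqrt_mem hE) (Ioo_subset_Icc_self hx)).2 hlt.1,
      (W.lt_position_iff (W.sqrt_mem hE) (Ioo_subset_Icc_self hx)).2 hlt.2⟩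
  · intro hx
    have hmem : x ∈ Ioo l r := ⟨(W.position_mem (W.neg_sqrt_mem hE)).1.trans hx.1,
      hx.2.trans (W.position_mem (W.sqrt_mem hE)).2⟩
    refine ⟨hmem, ?_⟩
    rw [← W.signedRoot_sq (Ioo_subset_Icc_self hmem), Real.sq_lt]
    exact ⟨(W.position_lt_iff (W.neg_sqrt_mem hE) (Ioo_subset_Icc_self hmem)).1 hx.1,
      (W.lt_position_iff (W.sqrt_mem hE) (Ioo_subset_Icc_self hmem)).1 hx.2⟩

theorem isOscillationInterval (W : IsPotentialWell V F l c r) (hE : E ∈ Ioo 0 (V l)) :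
    IsOscillationInterval V F E (position V l c r (-√E)) (position V l c r √E) := by
  have hroot := Real.sqrt_pos.2 hE.1
  have hleft := W.position_mem (W.neg_sqrt_mem hE)
  have hright := W.position_mem (W.sqrt_mem hE)
  have hsub : Icc (position V l c r (-√E)) (position V l c r √E) ⊆ Ioo l r :=
    Icc_subset_Ioo hleft.1 hright.2
  have hne : ∀ {s}, s ∈ Ioo (-√(V l)) √(V l) → s ≠ 0 → F (position V l c r s) ≠ 0 :=
    fun hs hs0 h0 => (W.positionDeriv_pos hs hs0).ne' (by rw [positionDeriv, h0, div_zero])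
  refine ⟨?_, ?_, ?_, fun x hx => (W.sublevel_eq_Ioo hE ▸ hx).2,
    fun x hx => W.hasDerivAt x (hsub hx), W.continuousOn_deriv.mono hsub,
    hne (W.neg_sqrt_mem hE) (neg_ne_zero.2 hroot.ne'), hne (W.sqrt_mem hE) hroot.ne'⟩
  · rw [W.position_lt_iff (W.neg_sqrt_mem hE) (Ioo_subset_Icc_self hright),
      W.signedRoot_position (W.sqrt_mem hE)]
    linarith
  · rw [← W.signedRoot_sq (Ioo_subset_Icc_self hleft), W.signedRoot_position (W.neg_sqrt_mem hE),
      neg_sq, Real.sq_sqrt hE.1.le]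
  · rw [← W.signedRoot_sq (Ioo_subset_Icc_self hright), W.signedRoot_position (W.sqrt_mem hE),
      Real.sq_sqrt hE.1.le]

end IsPotentialWell

end

section

variable {p E : ℝ} {V F : ℝ → ℝ} {l c r : ℝ}

/-! ### The period function of a well -/

/-- The period of the oscillations of energy `E` in the well `(l, r)` of the potential `V`. -/
noncomputable def period (p : ℝ) (V : ℝ → ℝ) (l r E : ℝ) : ℝ :=
  2 * ∫ x in {x ∈ Ioo l r | V x < E}, slowness p V E x

/-- The time density of an oscillation of unit energy in the potential `s ^ 2`, up to a constant. -/
noncomputable def timeKernel (p s : ℝ) : ℝ := (1 - s ^ 2) ^ (-(1 / p))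

lemma one_sub_sq_pos {s : ℝ} (hs : s ∈ Ioo (-1 : ℝ) 1) : 0 < 1 - s ^ 2 := by
  nlinarith [hs.1, hs.2]

lemma timeKernel_pos {s : ℝ} (hs : s ∈ Ioo (-1 : ℝ) 1) : 0 < timeKernel p s :=
  Real.rpow_pos_of_pos (one_sub_sq_pos hs) _

lemma timeKernel_neg (s : ℝ) : timeKernel p (-s) = timeKernel p s := by
  rw [timeKernel, neg_sq, timeKernel]

lemma measurable_timeKernel : Measurable (timeKernel p) := by
  unfold timeKernel
  fun_prop

lemma timeKernel_le (hp : 0 < p) {s : ℝ} (hs : s ∈ Ioo (-1 : ℝ) 1) :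
    timeKernel p s ≤ (1 - s) ^ (-(1 / p)) + (1 + s) ^ (-(1 / p)) := by
  have hexp : -(1 / p) ≤ 0 := neg_nonpos.2 (one_div_nonneg.2 hp.le)
  have h₁ : 0 < 1 - s := sub_pos.2 hs.2
  have h₂ : 0 < 1 + s := by linarith [hs.1]
  have hpow₁ := Real.rpow_nonneg h₁.le (-(1 / p))
  have hpow₂ := Real.rpow_nonneg h₂.le (-(1 / p))
  rw [timeKernel]
  rcases le_total 0 s with h | h
  · linarith [Real.rpow_le_rpow_of_nonpos h₁ (by nlinarith : 1 - s ≤ 1 - s ^ 2) hexp]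
  · linarith [Real.rpow_le_rpow_of_nonpos h₂ (by nlinarith : 1 + s ≤ 1 - s ^ 2) hexp]

lemma integrableOn_timeKernel (hp : 1 < p) : IntegrableOn (timeKernel p) (Ioo (-1) 1) := by
  have hexp : -1 < -(1 / p) := neg_lt_neg ((div_lt_one (zero_lt_one.trans hp)).2 hp)
  have h₁ : IntervalIntegrable (fun s : ℝ => (1 - s) ^ (-(1 / p))) volume (-1) 1 := by
    convert (intervalIntegral.intervalIntegrable_rpow' hexp (a := 2) (b := 0)).comp_sub_left 1
      using 1 <;> norm_num
  have h₂ : IntervalIntegrable (fun s : ℝ => (1 + s) ^ (-(1 / p))) volume (-1) 1 := by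
    convert (intervalIntegral.intervalIntegrable_rpow' hexp (a := 0) (b := 2)).comp_add_left 1
      using 1 <;> norm_num
  have hint := (intervalIntegrable_iff_integrableOn_Ioo_of_le (by norm_num)).1 (h₁.add h₂)
  refine Integrable.mono' hint measurable_timeKernel.aestronglyMeasurable
    ((ae_restrict_iff' measurableSet_Ioo).2 (.of_forall fun s hs => ?_))
  rw [Real.norm_of_nonneg (timeKernel_pos hs).le]
  exact timeKernel_le (zero_lt_one.trans hp) hs

lemma integral_timeKernel_mul_id :
    ∫ s in Ioo (-1 : ℝ) 1, timeKernel p s * s = 0 := by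
  have hodd := intervalIntegral.integral_comp_neg (a := -1) (b := 1)
    fun s : ℝ => timeKernel p s * s
  simp only [timeKernel_neg, mul_neg, neg_neg, intervalIntegral.integral_neg] at hodd
  rw [← integral_Ioc_eq_integral_Ioo, ← intervalIntegral.integral_of_le (by norm_num)]
  linarith

/-- The time density of the oscillations of energy `E` in the coordinate `signedRoot V c / √E`, up
to a power of `E`. -/
noncomputable def scaledDensity (p : ℝ) (V F : ℝ → ℝ) (l c r E s : ℝ) : ℝ :=
  timeKernel p s * positionDeriv V F l c r (√E * s)

/-- The period of the oscillations of energy `E`, up to a power of `E`. -/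
noncomputable def scaledPeriod (p : ℝ) (V F : ℝ → ℝ) (l c r E : ℝ) : ℝ :=
  ∫ s in Ioo (-1) 1, scaledDensity p V F l c r E s

namespace IsPotentialWell

lemma period_eq_integral_Ioo (W : IsPotentialWell V F l c r) (hE : E ∈ Ioo 0 (V l)) :
    period p V l r E = 2 * ∫ x in Ioo (position V l c r (-√E)) (position V l c r √E),
      slowness p V E x := by
  rw [period, W.sublevel_eq_Ioo hE]

theorem isMinimalPeriod {w : ℝ → ℝ} (W : IsPotentialWell V F l c r) (hp : 1 < p)
    (hE : E ∈ Ioo 0 (V l)) (hint : IntegrableOn (slowness p V E) {x ∈ Ioo l r | V x < E})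
    (h : IsTrajectory p V F E w) (hw : ∀ t, w t ∈ Ioo l r)
    (hper : ∃ S, 0 < S ∧ Function.Periodic w S) : IsMinimalPeriod w (period p V l r E) := by
  rw [W.sublevel_eq_Ioo hE] at hint
  have J := W.isOscillationInterval hE
  obtain ⟨Θ, hΘ⟩ := J.exists_isTimeMap hp hint
  rw [W.period_eq_integral_Ioo hE]
  refine h.isMinimalPeriod hp J (fun t => ?_) hΘ hper
  have hle := h.potential_le hp t
  rw [← W.signedRoot_sq (Ioo_subset_Icc_self (hw t)), Real.sq_le hE.1.le] at hle
  exact ⟨not_lt.1 (mt (W.lt_position_iff (W.neg_sqrt_mem hE) (Ioo_subset_Icc_self (hw t))).1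
    hle.1.not_gt), not_lt.1 (mt (W.position_lt_iff (W.sqrt_mem hE)
      (Ioo_subset_Icc_self (hw t))).1 hle.2.not_gt)⟩

theorem exists_periodic_isTrajectory (W : IsPotentialWell V F l c r) (hp : 1 < p)
    (hE : E ∈ Ioo 0 (V l)) (hint : IntegrableOn (slowness p V E) {x ∈ Ioo l r | V x < E}) :
    ∃ w, IsTrajectory p V F E w ∧ (∀ t, w t ∈ Ioo l r) ∧ ∃ S, 0 < S ∧ Function.Periodic w S := by
  rw [W.sublevel_eq_Ioo hE] at hint
  have J := W.isOscillationInterval hE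
  obtain ⟨Θ, hΘ⟩ := J.exists_isTimeMap hp hint
  have hτ := J.time_pos hΘ
  exact ⟨orbit Θ _, J.isTrajectory_orbit hΘ hp,
    fun t => Icc_subset_Ioo (W.position_mem (W.neg_sqrt_mem hE)).1
      (W.position_mem (W.sqrt_mem hE)).2 (J.orbit_mem_Icc hΘ t),
    _, mul_pos two_pos hτ, periodic_orbit hτ.ne'⟩

lemma measurableSet_sublevel (W : IsPotentialWell V F l c r) (hE : E ∈ Ioo 0 (V l)) :
    MeasurableSet {x ∈ Ioo l r | V x < E} := by
  rw [W.sublevel_eq_Ioo hE]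
  exact measurableSet_Ioo

lemma image_signedRoot_div (W : IsPotentialWell V F l c r) (hE : E ∈ Ioo 0 (V l)) :
    (fun x => signedRoot V c x / √E) ''
      ({x ∈ Ioo l r | V x < E} \ {c}) = Ioo (-1) 1 \ {0} := by
  have hroot := Real.sqrt_pos.2 hE.1
  have J := W.isOscillationInterval hE
  have hsub : Icc (position V l c r (-√E)) (position V l c r √E) ⊆ Icc l r :=
    Icc_subset_Icc (W.position_mem (W.neg_sqrt_mem hE)).1.le (W.position_mem (W.sqrt_mem hE)).2.le
  have hmem : c ∈ Ioo (position V l c r (-√E)) (position V l c r √E) := by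
    rw [← W.sublevel_eq_Ioo hE]
    exact ⟨W.mem, W.map_bottom.trans_lt hE.1⟩
  have hmap : signedRoot V c '' Ioo (position V l c r (-√E)) (position V l c r √E) =
      Ioo (-√E) √E := by
    rw [(W.continuousOn_signedRoot.mono hsub).image_Ioo_of_strictMonoOn J.lt.le
      (W.strictMonoOn_signedRoot.mono hsub), W.signedRoot_position (W.neg_sqrt_mem hE),
      W.signedRoot_position (W.sqrt_mem hE)]
  have hbij := (((W.strictMonoOn_signedRoot.injOn.mono hsub).mono
    Ioo_subset_Icc_self).bijOn_image.sdiff_singleton hmem).image_eq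
  rw [hmap, W.signedRoot_bottom] at hbij
  rw [W.sublevel_eq_Ioo hE]
  simp only [div_eq_mul_inv]
  rw [← image_image (fun s => s * (√E)⁻¹), hbij,
    image_sdiff (mul_left_injective₀ (inv_ne_zero hroot.ne')), image_singleton, zero_mul,
    image_mul_right_Ioo _ _ (inv_pos.2 hroot), neg_mul, mul_inv_cancel₀ hroot.ne']

lemma slowness_eq_smul (W : IsPotentialWell V F l c r) (hp : 1 < p) (hE : E ∈ Ioo 0 (V l)) {x : ℝ}
    (hx : x ∈ {x ∈ Ioo l r | V x < E} \ {c}) :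
    slowness p V E x = |(positionDeriv V F l c r (signedRoot V c x))⁻¹ / √E| •
      (p.conjExponent ^ (-(1 / p)) * E ^ (1 / 2 - 1 / p) *
        scaledDensity p V F l c r E (signedRoot V c x / √E)) := by
  have hroot := Real.sqrt_pos.2 hE.1
  obtain ⟨⟨hx, hlt⟩, hne⟩ := hx
  have hmem := Ioo_subset_Icc_self hx
  have hpos : 0 < positionDeriv V F l c r (signedRoot V c x) := by
    refine W.positionDeriv_pos (W.bijOn_signedRoot.mapsTo hx) fun h0 => hne ?_
    exact W.bijOn_signedRoot.injOn hx W.mem (h0.trans W.signedRoot_bottom.symm)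
  have hscale : p.conjExponent * (E - V x) =
      p.conjExponent * E * (1 - (signedRoot V c x / √E) ^ 2) := by
    rw [div_pow, Real.sq_sqrt hE.1.le, W.signedRoot_sq hmem]
    field_simp [hE.1.ne']
  have hnonneg : 0 ≤ 1 - (signedRoot V c x / √E) ^ 2 := by
    rw [div_pow, Real.sq_sqrt hE.1.le, W.signedRoot_sq hmem, sub_nonneg, div_le_one hE.1]
    exact hlt.le
  have hconj := (Real.HolderConjugate.conjExponent hp).symm.nonneg
  rw [slowness, hscale, Real.mul_rpow (mul_nonneg hconj hE.1.le) hnonneg,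
    Real.mul_rpow hconj hE.1.le, ← timeKernel, scaledDensity, mul_div_cancel₀ _ hroot.ne',
    abs_of_pos (div_pos (inv_pos.2 hpos) hroot), smul_eq_mul, sub_eq_add_neg (1 / 2 : ℝ),
    Real.rpow_add hE.1, ← Real.sqrt_eq_rpow]
  field_simp

lemma hasDerivWithinAt_signedRoot_div (W : IsPotentialWell V F l c r) :
    ∀ x ∈ {x ∈ Ioo l r | V x < E} \ {c}, HasDerivWithinAt (fun x => signedRoot V c x / √E)
      ((positionDeriv V F l c r (signedRoot V c x))⁻¹ / √E) ({x ∈ Ioo l r | V x < E} \ {c}) x :=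
  fun _ hx => ((W.hasDerivAt_signedRoot hx.1.1 hx.2).div_const _).hasDerivWithinAt

lemma injOn_signedRoot_div (W : IsPotentialWell V F l c r) (hE : 0 < E) :
    InjOn (fun x => signedRoot V c x / √E) ({x ∈ Ioo l r | V x < E} \ {c}) :=
  fun _ hx _ hy hxy =>
    W.bijOn_signedRoot.injOn hx.1.1 hy.1.1 ((div_left_inj' (Real.sqrt_pos.2 hE).ne').1 hxy)

theorem integrableOn_slowness (W : IsPotentialWell V F l c r) (hp : 1 < p) (hE : E ∈ Ioo 0 (V l))
    (hint : IntegrableOn (scaledDensity p V F l c r E) (Ioo (-1) 1)) :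
    IntegrableOn (slowness p V E) {x ∈ Ioo l r | V x < E} := by
  have hmeas : MeasurableSet ({x ∈ Ioo l r | V x < E} \ {c}) :=
    (W.measurableSet_sublevel hE).diff (measurableSet_singleton c)
  refine IntegrableOn.congr_set_ae ?_ (sdiff_null_ae_eq_self (measure_singleton c)).symm
  refine ((integrableOn_image_iff_integrableOn_abs_deriv_smul hmeas
    W.hasDerivWithinAt_signedRoot_div (W.injOn_signedRoot_div hE.1)
    fun s => p.conjExponent ^ (-(1 / p)) * E ^ (1 / 2 - 1 / p) *
      scaledDensity p V F l c r E s).1 ?_).congr_fun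
    (fun x hx => (W.slowness_eq_smul hp hE hx).symm) hmeas
  rw [W.image_signedRoot_div hE]
  exact (hint.mono_set sdiff_subset).const_mul _

theorem period_eq_scaledPeriod (W : IsPotentialWell V F l c r) (hp : 1 < p)
    (hE : E ∈ Ioo 0 (V l)) : period p V l r E =
      2 * p.conjExponent ^ (-(1 / p)) * (E ^ (1 / 2 - 1 / p) * scaledPeriod p V F l c r E) := by
  have hmeas : MeasurableSet ({x ∈ Ioo l r | V x < E} \ {c}) :=
    (W.measurableSet_sublevel hE).diff (measurableSet_singleton c)
  rw [period, ← setIntegral_congr_set (sdiff_null_ae_eq_self (measure_singleton c)),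
    setIntegral_congr_fun hmeas fun x hx => W.slowness_eq_smul hp hE hx,
    ← integral_image_eq_integral_abs_deriv_smul hmeas W.hasDerivWithinAt_signedRoot_div
      (W.injOn_signedRoot_div hE.1) fun s => p.conjExponent ^ (-(1 / p)) * E ^ (1 / 2 - 1 / p) *
        scaledDensity p V F l c r E s, W.image_signedRoot_div hE,
    setIntegral_congr_set (sdiff_null_ae_eq_self (measure_singleton 0)), integral_const_mul,
    scaledPeriod]
  ring

end IsPotentialWell

end

section

variable {p E k : ℝ} {V F F' : ℝ → ℝ} {l c r : ℝ}

/-! ### Monotonicity of the period -/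

lemma integrableOn_timeKernel_mul_id (hp : 1 < p) :
    IntegrableOn (fun s => timeKernel p s * s) (Ioo (-1) 1) :=
  integrableOn_mul_of_antitoneOn_of_monotoneOn (m := -1) (integrableOn_timeKernel hp)
    (by simp [AntitoneOn])
    (fun _ _ _ _ h => h) fun _ hs => hs.1.le

/-- A well on which `V` satisfies Chicone's condition, corrected by a multiple of `F ^ 3`: the
expression in `chicone` is `√V * F ^ 2` times the derivative of `√V / F + 2 * k * √V`. -/
structure IsChiconeWell (V F F' : ℝ → ℝ) (k l c r : ℝ) : Prop extends
    IsPotentialWell V F l c r where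
  hasDerivAt_deriv : ∀ x ∈ Ioo l r, HasDerivAt F (F' x) x
  chicone : ∀ x ∈ Ioo l r, 0 ≤ F x ^ 2 / 2 - V x * F' x + k * F x ^ 3

/-- `positionDeriv` with an odd term added, which makes it monotone on either side of `0` without
changing the period. -/
noncomputable def correctedDeriv (V F : ℝ → ℝ) (k l c r s : ℝ) : ℝ :=
  positionDeriv V F l c r s + 4 * k * s

namespace IsPotentialWell

lemma positionDeriv_nonneg (W : IsPotentialWell V F l c r) {s : ℝ}
    (hs : s ∈ Ioo (-√(V l)) √(V l)) : 0 ≤ positionDeriv V F l c r s := by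
  rcases eq_or_ne s 0 with rfl | hne
  · simp [positionDeriv]
  · exact (W.positionDeriv_pos hs hne).le

lemma sqrt_mul_mem (W : IsPotentialWell V F l c r) (hE : E ∈ Ioo 0 (V l)) {s : ℝ}
    (hs : s ∈ Icc (-1 : ℝ) 1) : √E * s ∈ Ioo (-√(V l)) √(V l) :=
  Icc_subset_Ioo (W.neg_sqrt_mem hE).1 (W.sqrt_mem hE).2
    ⟨by nlinarith [Real.sqrt_nonneg E, hs.1], by nlinarith [Real.sqrt_nonneg E, hs.2]⟩

lemma scaledPeriod_pos (W : IsPotentialWell V F l c r) (hE : E ∈ Ioo 0 (V l))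
    (hint : IntegrableOn (scaledDensity p V F l c r E) (Ioo (-1) 1)) :
    0 < scaledPeriod p V F l c r E := by
  have hpos : ∀ s ∈ Ioo (0 : ℝ) 1, 0 < scaledDensity p V F l c r E s := fun s hs =>
    have hmem : s ∈ Ioo (-1 : ℝ) 1 := ⟨by linarith [hs.1], hs.2⟩
    mul_pos (timeKernel_pos hmem) (W.positionDeriv_pos
      (W.sqrt_mul_mem hE (Ioo_subset_Icc_self hmem)) (mul_pos (Real.sqrt_pos.2 hE.1) hs.1).ne')
  have hsub : Ioo (0 : ℝ) 1 ⊆ Ioo (-1) 1 := Ioo_subset_Ioo_left (by norm_num)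
  calc (0 : ℝ) < ∫ s in Ioo 0 1, scaledDensity p V F l c r E s := by
        rw [← integral_Ioc_eq_integral_Ioo, ← intervalIntegral.integral_of_le zero_le_one]
        exact intervalIntegral.intervalIntegral_pos_of_pos_on
          ((intervalIntegrable_iff_integrableOn_Ioo_of_le zero_le_one).2 (hint.mono_set hsub))
          hpos one_pos
    _ ≤ _ := setIntegral_mono_set hint ((ae_restrict_iff' measurableSet_Ioo).2
        (.of_forall fun s hs => mul_nonneg (timeKernel_pos hs).le
          (W.positionDeriv_nonneg (W.sqrt_mul_mem hE (Ioo_subset_Icc_self hs)))))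
        hsub.eventuallyLE

end IsPotentialWell

namespace IsChiconeWell

lemma hasDerivAt_correctedDeriv_signedRoot (W : IsChiconeWell V F F' k l c r) {x : ℝ}
    (hx : x ∈ Ioo l r) (hne : x ≠ c) :
    HasDerivAt (fun x => correctedDeriv V F k l c r (signedRoot V c x))
      (2 * (F x ^ 2 / 2 - V x * F' x + k * F x ^ 3) / (signedRoot V c x * F x ^ 2)) x := by
  have hS : signedRoot V c x ≠ 0 := fun h0 => hne <| W.bijOn_signedRoot.injOn hx W.mem
    (h0.trans W.signedRoot_bottom.symm)
  have hF : F x ≠ 0 := by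
    rcases lt_or_gt_of_ne hne with h | h
    exacts [(W.neg_of_lt x ⟨hx.1, h⟩).ne, (W.pos_of_gt x ⟨h, hx.2⟩).ne']
  have hroot := W.hasDerivAt_signedRoot hx hne
  rw [positionDeriv, W.position_signedRoot hx, inv_div] at hroot
  have hder := ((hroot.const_mul 2).div (W.hasDerivAt_deriv x hx) hF).add
    (hroot.const_mul (4 * k))
  refine (hder.congr_deriv ?_).congr_of_eventuallyEq ?_
  · rw [← W.signedRoot_sq (Ioo_subset_Icc_self hx)]
    field_simp
    ring
  · filter_upwards [isOpen_Ioo.mem_nhds hx] with y hy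
    simp only [correctedDeriv, positionDeriv, W.position_signedRoot hy, Pi.add_apply, Pi.div_apply]

lemma antitoneOn_correctedDeriv (W : IsChiconeWell V F F' k l c r) :
    AntitoneOn (correctedDeriv V F k l c r) (Ioo (-√(V l)) 0) := by
  have hmem : ∀ s ∈ Ioo (-√(V l)) 0, s ∈ Ioo (-√(V l)) √(V l) := fun s hs =>
    ⟨hs.1, hs.2.trans (Real.sqrt_pos.2 W.depth_pos)⟩
  have hanti : AntitoneOn (fun x => correctedDeriv V F k l c r (signedRoot V c x)) (Ioo l c) := by
    have hder := fun x (hx : x ∈ Ioo l c) =>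
      W.hasDerivAt_correctedDeriv_signedRoot ⟨hx.1, hx.2.trans W.mem.2⟩ hx.2.ne
    refine antitoneOn_of_hasDerivWithinAt_nonpos (convex_Ioo l c)
      (fun x hx => (hder x hx).continuousAt.continuousWithinAt)
      (fun x hx => (hder x (interior_subset hx)).hasDerivWithinAt) fun x hx => ?_
    replace hx := interior_subset hx
    have hchicone := W.chicone x ⟨hx.1, hx.2.trans W.mem.2⟩
    rw [W.signedRoot_of_le hx.2.le]
    exact div_nonpos_of_nonneg_of_nonpos (by linarith)
      (mul_nonpos_of_nonpos_of_nonneg (neg_nonpos.2 (Real.sqrt_nonneg _)) (sq_nonneg _))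
  have hpos : ∀ s ∈ Ioo (-√(V l)) 0, position V l c r s ∈ Ioo l c := fun s hs =>
    ⟨(W.position_mem (hmem s hs)).1, (W.position_lt_iff (hmem s hs)
      (Ioo_subset_Icc_self W.mem)).2 (by rw [W.signedRoot_bottom]; exact hs.2)⟩
  intro s hs t ht hst
  have hle := hanti (hpos s hs) (hpos t ht) (W.monotoneOn_position (hmem s hs) (hmem t ht) hst)
  simpa only [W.signedRoot_position (hmem s hs), W.signedRoot_position (hmem t ht)] using hle

lemma monotoneOn_correctedDeriv (W : IsChiconeWell V F F' k l c r) :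
    MonotoneOn (correctedDeriv V F k l c r) (Ioo 0 √(V l)) := by
  have hmem : ∀ s ∈ Ioo 0 √(V l), s ∈ Ioo (-√(V l)) √(V l) := fun s hs =>
    ⟨by linarith [hs.1, hs.2], hs.2⟩
  have hmono : MonotoneOn (fun x => correctedDeriv V F k l c r (signedRoot V c x)) (Ioo c r) := by
    have hder := fun x (hx : x ∈ Ioo c r) =>
      W.hasDerivAt_correctedDeriv_signedRoot ⟨W.mem.1.trans hx.1, hx.2⟩ hx.1.ne'
    refine monotoneOn_of_hasDerivWithinAt_nonneg (convex_Ioo c r)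
      (fun x hx => (hder x hx).continuousAt.continuousWithinAt)
      (fun x hx => (hder x (interior_subset hx)).hasDerivWithinAt) fun x hx => ?_
    replace hx := interior_subset hx
    have hchicone := W.chicone x ⟨W.mem.1.trans hx.1, hx.2⟩
    rw [W.signedRoot_of_ge hx.1.le]
    exact div_nonneg (by linarith) (mul_nonneg (Real.sqrt_nonneg _) (sq_nonneg _))
  have hpos : ∀ s ∈ Ioo 0 √(V l), position V l c r s ∈ Ioo c r := fun s hs =>
    ⟨(W.lt_position_iff (hmem s hs) (Ioo_subset_Icc_self W.mem)).2
      (by rw [W.signedRoot_bottom]; exact hs.1), (W.position_mem (hmem s hs)).2⟩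
  intro s hs t ht hst
  have hle := hmono (hpos s hs) (hpos t ht) (W.monotoneOn_position (hmem s hs) (hmem t ht) hst)
  simpa only [W.signedRoot_position (hmem s hs), W.signedRoot_position (hmem t ht)] using hle

lemma integrableOn_timeKernel_mul_correctedDeriv (W : IsChiconeWell V F F' k l c r) (hp : 1 < p)
    (hE : E ∈ Ioo 0 (V l)) :
    IntegrableOn (fun s => timeKernel p s * correctedDeriv V F k l c r (√E * s)) (Ioo (-1) 1) := by
  have hroot := Real.sqrt_pos.2 hE.1
  have hmono : Monotone fun s => √E * s := fun _ _ h => mul_le_mul_of_nonneg_left h hroot.le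
  refine integrableOn_mul_of_antitoneOn_of_monotoneOn (m := 0) (A := -(4 * |k| * √E))
    (integrableOn_timeKernel hp)
    (W.antitoneOn_correctedDeriv.comp_MonotoneOn (hmono.monotoneOn _) fun s hs => ?_)
    (W.monotoneOn_correctedDeriv.comp (hmono.monotoneOn _) fun s hs => ?_) fun s hs => ?_
  · exact ⟨(W.sqrt_mul_mem hE ⟨hs.1, by linarith [hs.2]⟩).1, mul_neg_of_pos_of_neg hroot hs.2⟩
  · exact ⟨mul_pos hroot hs.1, (W.sqrt_mul_mem hE ⟨by linarith [hs.1], hs.2⟩).2⟩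
  · have hnonneg := W.positionDeriv_nonneg (W.sqrt_mul_mem hE (Ioo_subset_Icc_self hs))
    have hlinear : |4 * k * (√E * s)| ≤ 4 * |k| * √E := by
      rw [abs_mul, abs_mul, abs_mul, abs_of_pos hroot, abs_of_pos (zero_lt_four' ℝ)]
      have hs' : |s| ≤ 1 := abs_le.2 ⟨hs.1.le, hs.2.le⟩
      exact mul_le_mul_of_nonneg_left (mul_le_of_le_one_right hroot.le hs') (by positivity)
    rw [correctedDeriv]
    linarith [neg_abs_le (4 * k * (√E * s))]

lemma scaledDensity_eq (E s : ℝ) : scaledDensity p V F l c r E s =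
    timeKernel p s * correctedDeriv V F k l c r (√E * s) - 4 * k * √E * (timeKernel p s * s) := by
  rw [scaledDensity, correctedDeriv]
  ring

lemma integrableOn_scaledDensity (W : IsChiconeWell V F F' k l c r) (hp : 1 < p)
    (hE : E ∈ Ioo 0 (V l)) : IntegrableOn (scaledDensity p V F l c r E) (Ioo (-1) 1) := by
  simp_rw [funext (scaledDensity_eq (k := k) E)]
  exact (W.integrableOn_timeKernel_mul_correctedDeriv hp hE).sub
    ((integrableOn_timeKernel_mul_id hp).const_mul _)

lemma scaledPeriod_eq (W : IsChiconeWell V F F' k l c r) (hp : 1 < p) (hE : E ∈ Ioo 0 (V l)) :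
    scaledPeriod p V F l c r E =
      ∫ s in Ioo (-1) 1, timeKernel p s * correctedDeriv V F k l c r (√E * s) := by
  simp_rw [scaledPeriod, scaledDensity_eq (k := k)]
  rw [integral_sub (W.integrableOn_timeKernel_mul_correctedDeriv hp hE)
    ((integrableOn_timeKernel_mul_id hp).const_mul _), integral_const_mul,
    integral_timeKernel_mul_id, mul_zero, sub_zero]

theorem monotoneOn_scaledPeriod (W : IsChiconeWell V F F' k l c r) (hp : 1 < p) :
    MonotoneOn (scaledPeriod p V F l c r) (Ioo 0 (V l)) := by
  intro E hE E' hE' hle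
  rw [W.scaledPeriod_eq hp hE, W.scaledPeriod_eq hp hE']
  refine setIntegral_mono_on (W.integrableOn_timeKernel_mul_correctedDeriv hp hE)
    (W.integrableOn_timeKernel_mul_correctedDeriv hp hE') measurableSet_Ioo fun s hs =>
    mul_le_mul_of_nonneg_left ?_ (timeKernel_pos hs).le
  have hroot := Real.sqrt_pos.2 hE.1
  have hroot' := Real.sqrt_pos.2 hE'.1
  have hmem := W.sqrt_mul_mem hE (Ioo_subset_Icc_self hs)
  have hmem' := W.sqrt_mul_mem hE' (Ioo_subset_Icc_self hs)
  have hsqrt := Real.sqrt_le_sqrt hle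
  rcases lt_trichotomy s 0 with h | rfl | h
  · exact W.antitoneOn_correctedDeriv ⟨hmem'.1, mul_neg_of_pos_of_neg hroot' h⟩
      ⟨hmem.1, mul_neg_of_pos_of_neg hroot h⟩ (mul_le_mul_of_nonpos_right hsqrt h.le)
  · rw [mul_zero, mul_zero]
  · exact W.monotoneOn_correctedDeriv ⟨mul_pos hroot h, hmem.2⟩ ⟨mul_pos hroot' h, hmem'.2⟩
      (mul_le_mul_of_nonneg_right hsqrt h.le)

theorem integrableOn_slowness (W : IsChiconeWell V F F' k l c r) (hp : 1 < p)
    (hE : E ∈ Ioo 0 (V l)) : IntegrableOn (slowness p V E) {x ∈ Ioo l r | V x < E} :=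
  W.toIsPotentialWell.integrableOn_slowness hp hE (W.integrableOn_scaledDensity hp hE)

lemma scaledPeriod_pos (W : IsChiconeWell V F F' k l c r) (hp : 1 < p) (hE : E ∈ Ioo 0 (V l)) :
    0 < scaledPeriod p V F l c r E :=
  W.toIsPotentialWell.scaledPeriod_pos hE (W.integrableOn_scaledDensity hp hE)

theorem strictMonoOn_period (W : IsChiconeWell V F F' k l c r) (hp : 2 < p) :
    StrictMonoOn (period p V l r) (Ioo 0 (V l)) := by
  have hp1 := one_lt_two.trans hp
  have hexp : 0 < 1 / 2 - 1 / p := sub_pos.2 (one_div_lt_one_div_of_lt two_pos hp)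
  intro E hE E' hE' hlt
  rw [W.period_eq_scaledPeriod hp1 hE, W.period_eq_scaledPeriod hp1 hE']
  have hconst := Real.rpow_pos_of_pos (Real.HolderConjugate.conjExponent hp1).symm.pos (-(1 / p))
  refine mul_lt_mul_of_pos_left ?_ (mul_pos two_pos hconst)
  calc E ^ (1 / 2 - 1 / p) * scaledPeriod p V F l c r E
      < E' ^ (1 / 2 - 1 / p) * scaledPeriod p V F l c r E :=
        mul_lt_mul_of_pos_right (Real.rpow_lt_rpow hE.1.le hlt hexp) (W.scaledPeriod_pos hp1 hE)
    _ ≤ E' ^ (1 / 2 - 1 / p) * scaledPeriod p V F l c r E' :=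
        mul_le_mul_of_nonneg_left (W.monotoneOn_scaledPeriod hp1 hE hE' hlt.le)
          (Real.rpow_nonneg hE'.1.le _)

theorem tendsto_period_zero (W : IsChiconeWell V F F' k l c r) (hp : 2 < p) :
    Tendsto (period p V l r) (𝓝[>] 0) (𝓝 0) := by
  have hp1 := one_lt_two.trans hp
  have hexp : 0 < 1 / 2 - 1 / p := sub_pos.2 (one_div_lt_one_div_of_lt two_pos hp)
  have hconst := Real.rpow_pos_of_pos (Real.HolderConjugate.conjExponent hp1).symm.pos (-(1 / p))
  obtain ⟨E₀, hE₀⟩ := exists_between W.depth_pos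
  have hlim : Tendsto (fun E : ℝ => 2 * p.conjExponent ^ (-(1 / p)) *
      (E ^ (1 / 2 - 1 / p) * scaledPeriod p V F l c r E₀)) (𝓝[>] 0) (𝓝 0) := by
    have hpow := (Real.continuousAt_rpow_const 0 _ (.inr hexp.le)).tendsto.mono_left
      (nhdsWithin_le_nhds (s := Ioi 0))
    rw [Real.zero_rpow hexp.ne'] at hpow
    simpa using (hpow.mul_const (scaledPeriod p V F l c r E₀)).const_mul
      (2 * p.conjExponent ^ (-(1 / p)))
  have hnear : ∀ᶠ E in 𝓝[>] 0, E ∈ Ioo 0 E₀ := Ioo_mem_nhdsGT hE₀.1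
  refine squeeze_zero' ?_ ?_ hlim <;> filter_upwards [hnear] with E hE
  all_goals
    have hE' : E ∈ Ioo 0 (V l) := ⟨hE.1, hE.2.trans hE₀.2⟩
    have hpow := Real.rpow_pos_of_pos hE.1 (1 / 2 - 1 / p)
    rw [W.period_eq_scaledPeriod hp1 hE']
  · have hpos := W.scaledPeriod_pos hp1 hE'
    positivity
  · have hle := W.monotoneOn_scaledPeriod hp1 hE' hE₀ hE.2.le
    gcongr

end IsChiconeWell

end

section

variable {p E : ℝ} {V F : ℝ → ℝ} {l c r : ℝ}

lemma le_slowness_of_sub_le (hp : 1 < p) {C x : ℝ} (hC : 0 < C) (hlx : l < x)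
    (hV : V l - V x ≤ C * (x - l) ^ p) (hxE : V x < E) (hE : E ≤ V l) :
    (p.conjExponent * C) ^ (-(1 / p)) * (x - l)⁻¹ ≤ slowness p V E x := by
  have hp0 := zero_lt_one.trans hp
  have hconj := (Real.HolderConjugate.conjExponent hp).symm.pos
  have hinv : (x - l)⁻¹ = ((x - l) ^ p) ^ (-(1 / p)) := by
    rw [← Real.rpow_mul (sub_pos.2 hlx).le, mul_neg, mul_one_div_cancel hp0.ne',
      Real.rpow_neg_one]
  rw [hinv, ← Real.mul_rpow (mul_pos hconj hC).le (Real.rpow_nonneg (sub_pos.2 hlx).le _),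
    slowness, mul_assoc]
  exact Real.rpow_le_rpow_of_nonpos (mul_pos hconj (sub_pos.2 hxE))
    (mul_le_mul_of_nonneg_left (by linarith) hconj.le) (neg_nonpos.2 (one_div_pos.2 hp0).le)

namespace IsPotentialWell

lemma le_period (W : IsPotentialWell V F l c r) (hp : 1 < p)
    (hint : IntegrableOn (slowness p V E) {x ∈ Ioo l r | V x < E}) {C y : ℝ} (hC : 0 < C)
    (hV : ∀ x ∈ Ioo l c, V l - V x ≤ C * (x - l) ^ p) (hy : y ∈ Ioo l c)
    (hE : E ∈ Ioo (V y) (V l)) :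
    2 * ((p.conjExponent * C) ^ (-(1 / p)) * Real.log ((c - l) / (y - l))) ≤ period p V l r E := by
  have hE0 : E ∈ Ioo 0 (V l) :=
    ⟨(W.map_nonneg ⟨hy.1.le, (hy.2.trans W.mem.2).le⟩).trans_lt hE.1, hE.2⟩
  have hsub : Ioo y c ⊆ {x ∈ Ioo l r | V x < E} := fun x hx =>
    ⟨⟨hy.1.trans hx.1, hx.2.trans W.mem.2⟩,
      (W.strictAntiOn ⟨hy.1.le, hy.2.le⟩ ⟨(hy.1.trans hx.1).le, hx.2.le⟩ hx.1).trans hE.1⟩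
  have hlog : ∫ x in Ioo y c, (x - l)⁻¹ = Real.log ((c - l) / (y - l)) := by
    rw [← integral_Ioc_eq_integral_Ioo, ← intervalIntegral.integral_of_le hy.2.le,
      intervalIntegral.integral_comp_sub_right (fun x => x⁻¹),
      integral_inv_of_pos (sub_pos.2 hy.1) (sub_pos.2 W.mem.1)]
  have hinv : IntegrableOn (fun x => (x - l)⁻¹) (Ioo y c) := by
    rw [← intervalIntegrable_iff_integrableOn_Ioo_of_le hy.2.le]
    refine intervalIntegral.intervalIntegrable_inv (fun x hx => ?_) (by fun_prop)
    rw [uIcc_of_le hy.2.le] at hx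
    exact (sub_pos.2 (hy.1.trans_le hx.1)).ne'
  rw [period, ← hlog, ← integral_const_mul]
  refine mul_le_mul_of_nonneg_left ?_ two_pos.le
  calc _ ≤ ∫ x in Ioo y c, slowness p V E x :=
        setIntegral_mono_on (hinv.const_mul _) (hint.mono_set hsub) measurableSet_Ioo
          fun x hx => le_slowness_of_sub_le hp hC (hy.1.trans hx.1)
            (hV x ⟨hy.1.trans hx.1, hx.2⟩) (hsub hx).2 hE.2.le
    _ ≤ _ := setIntegral_mono_set hint ((ae_restrict_iff' (W.measurableSet_sublevel hE0)).2
        (.of_forall fun x hx => (slowness_pos hp hx.2).le)) hsub.eventuallyLE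

theorem tendsto_period_atTop (W : IsPotentialWell V F l c r) (hp : 1 < p)
    (hint : ∀ E ∈ Ioo 0 (V l), IntegrableOn (slowness p V E) {x ∈ Ioo l r | V x < E})
    {C : ℝ} (hC : 0 < C) (hV : ∀ x ∈ Ioo l c, V l - V x ≤ C * (x - l) ^ p) :
    Tendsto (period p V l r) (𝓝[<] (V l)) atTop := by
  have hconst : 0 < (p.conjExponent * C) ^ (-(1 / p)) :=
    Real.rpow_pos_of_pos (mul_pos (Real.HolderConjugate.conjExponent hp).symm.pos hC) _
  have hsub : Tendsto (fun y => y - l) (𝓝[>] l) (𝓝[>] 0) := by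
    refine tendsto_nhdsWithin_iff.2 ⟨?_, ?_⟩
    · simpa using ((continuous_sub_right l).tendsto l).mono_left nhdsWithin_le_nhds
    · filter_upwards [self_mem_nhdsWithin] with y hy using mem_Ioi.2 (sub_pos.2 hy)
  have hlog : Tendsto (fun y => 2 * ((p.conjExponent * C) ^ (-(1 / p)) *
      Real.log ((c - l) / (y - l)))) (𝓝[>] l) atTop :=
    ((Real.tendsto_log_atTop.comp ((tendsto_inv_nhdsGT_zero.comp hsub).const_mul_atTop
      (sub_pos.2 W.mem.1))).const_mul_atTop hconst).const_mul_atTop two_pos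
  refine tendsto_atTop.2 fun M => ?_
  obtain ⟨y, hM, hy⟩ := ((hlog.eventually_ge_atTop M).and (Ioo_mem_nhdsGT W.mem.1)).exists
  have hVy : V y < V l :=
    W.strictAntiOn ⟨le_rfl, W.mem.1.le⟩ ⟨hy.1.le, hy.2.le⟩ hy.1
  filter_upwards [Ioo_mem_nhdsLT hVy] with E hE
  have hE0 : 0 < E := (W.map_nonneg ⟨hy.1.le, (hy.2.trans W.mem.2).le⟩).trans_lt hE.1
  exact hM.trans (W.le_period hp (hint E ⟨hE0, hE.2⟩) hC hV hy hE)

end IsPotentialWell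

end

section

variable {p q x E : ℝ} {w : ℝ → ℝ}

/-! ### The potential `|x|^q / q - |x|^p / p` -/

/-- The derivative of the potential. -/
noncomputable def potentialDeriv (p q x : ℝ) : ℝ := phi q x - phi p x

/-- The second derivative of the potential on the positive half-line. -/
noncomputable def potentialDeriv₂ (p q x : ℝ) : ℝ :=
  (q - 1) * x ^ (q - 2) - (p - 1) * x ^ (p - 2)

/-- The third derivative of the potential on the positive half-line. -/
noncomputable def potentialDeriv₃ (p q x : ℝ) : ℝ :=
  (q - 1) * (q - 2) * x ^ (q - 3) - (p - 1) * (p - 2) * x ^ (p - 3)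

/-- The maximum of the homoclinic orbit, that is, the positive zero of `V - E_*`. -/
noncomputable def homoclinicMax (p q : ℝ) : ℝ := (q / p) ^ (q - p)⁻¹

lemma hasDerivAt_potential (hp : 1 < p) (hq : 1 < q) (x : ℝ) :
    HasDerivAt (potential p q) (potentialDeriv p q x) x := by
  have h := ((((hasDerivAt_abs_rpow x hq).div_const q).sub
    ((hasDerivAt_abs_rpow x hp).div_const p)).add_const (1 / p)).sub_const (1 / q)
  refine h.congr_deriv ?_
  rw [potentialDeriv, phi, phi]
  field_simp

lemma continuous_potentialDeriv (hp : 1 < p) (hq : 1 < q) : Continuous (potentialDeriv p q) :=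
  (continuous_phi hq).sub (continuous_phi hp)

lemma potentialDeriv_of_pos (hp : 1 < p) (hq : 1 < q) (hx : 0 < x) :
    potentialDeriv p q x = x ^ (p - 1) * (x ^ (q - p) - 1) := by
  rw [potentialDeriv, phi_of_nonneg hq.ne' hx.le, phi_of_nonneg hp.ne' hx.le, mul_sub_one,
    ← Real.rpow_add hx, sub_add_sub_comm, add_comm p q, ← sub_add_sub_comm, sub_self, add_zero]

lemma hasDerivAt_potentialDeriv (hp : 1 < p) (hq : 1 < q) (hx : 0 < x) :
    HasDerivAt (potentialDeriv p q) (potentialDeriv₂ p q x) x := by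
  have h := (Real.hasDerivAt_rpow_const (p := q - 1) (Or.inl hx.ne')).sub
    (Real.hasDerivAt_rpow_const (p := p - 1) (Or.inl hx.ne'))
  rw [show q - 1 - 1 = q - 2 by ring, show p - 1 - 1 = p - 2 by ring] at h
  refine h.congr_of_eventuallyEq ?_
  filter_upwards [lt_mem_nhds hx] with y hy
  rw [potentialDeriv, phi_of_nonneg hq.ne' hy.le, phi_of_nonneg hp.ne' hy.le, Pi.sub_apply]

lemma hasDerivAt_potentialDeriv₂ (hx : 0 < x) :
    HasDerivAt (potentialDeriv₂ p q) (potentialDeriv₃ p q x) x := by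
  have h := ((Real.hasDerivAt_rpow_const (p := q - 2) (Or.inl hx.ne')).const_mul (q - 1)).sub
    ((Real.hasDerivAt_rpow_const (p := p - 2) (Or.inl hx.ne')).const_mul (p - 1))
  refine h.congr_deriv ?_
  rw [potentialDeriv₃, show q - 2 - 1 = q - 3 by ring, show p - 2 - 1 = p - 3 by ring]
  ring

lemma potentialDeriv₂_of_pos (hx : 0 < x) :
    potentialDeriv₂ p q x = x ^ (p - 3) * x * ((q - 1) * x ^ (q - p) - (p - 1)) := by
  rw [potentialDeriv₂, show q - 2 = p - 3 + 1 + (q - p) by ring,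
    show p - 2 = p - 3 + 1 by ring, Real.rpow_add hx, Real.rpow_add hx, Real.rpow_one]
  ring

lemma potentialDeriv₃_of_pos (hx : 0 < x) :
    potentialDeriv₃ p q x =
      x ^ (p - 3) * ((q - 1) * (q - 2) * x ^ (q - p) - (p - 1) * (p - 2)) := by
  rw [potentialDeriv₃, show q - 3 = p - 3 + (q - p) by ring, Real.rpow_add hx]
  ring

lemma potentialDeriv₂_pos_iff (hx : 0 < x) :
    0 < potentialDeriv₂ p q x ↔ p - 1 < (q - 1) * x ^ (q - p) := by
  rw [potentialDeriv₂_of_pos hx,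
    mul_pos_iff_of_pos_left (mul_pos (Real.rpow_pos_of_pos hx _) hx), sub_pos]

lemma potentialDeriv₂_pos_of_mem_uIcc {y : ℝ} (hp : 1 < p) (hpq : p < q) (hx : 0 < x)
    (h : 0 < potentialDeriv₂ p q x) (hy : y ∈ uIcc 1 x) : 0 < potentialDeriv₂ p q y := by
  have hy₀ : 0 < y := (lt_min one_pos hx).trans_le hy.1
  rw [potentialDeriv₂_pos_iff hx] at h
  rw [potentialDeriv₂_pos_iff hy₀]
  rcases min_le_iff.1 hy.1 with h₁ | hxy
  · have := Real.one_le_rpow h₁ (sub_pos.2 hpq).le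
    nlinarith
  · have := Real.rpow_le_rpow hx.le hxy (sub_pos.2 hpq).le
    nlinarith

lemma potentialDeriv_neg (hp : 1 < p) (hpq : p < q) (hx : 0 < x) (hx₁ : x < 1) :
    potentialDeriv p q x < 0 := by
  rw [potentialDeriv_of_pos hp (hp.trans hpq) hx]
  exact mul_neg_of_pos_of_neg (Real.rpow_pos_of_pos hx _)
    (sub_neg.2 (Real.rpow_lt_one hx.le hx₁ (sub_pos.2 hpq)))

lemma potentialDeriv_pos (hp : 1 < p) (hpq : p < q) (hx : 1 < x) : 0 < potentialDeriv p q x := by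
  rw [potentialDeriv_of_pos hp (hp.trans hpq) (one_pos.trans hx)]
  exact mul_pos (Real.rpow_pos_of_pos (one_pos.trans hx) _)
    (sub_pos.2 (Real.one_lt_rpow hx (sub_pos.2 hpq)))

lemma potential_one : potential p q 1 = 0 := by simp [potential]

lemma potential_eq_Estar_sub (hp : 0 < p) (hq : 0 < q) (hx : 0 < x) :
    potential p q x = Estar p q - x ^ p * (1 / p - x ^ (q - p) / q) := by
  have hpow : x ^ q = x ^ p * x ^ (q - p) := by rw [← Real.rpow_add hx, add_sub_cancel]
  rw [Estar_eq hp hq, potential, abs_of_pos hx, hpow]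
  ring

lemma potential_lt_Estar_iff (hp : 0 < p) (hpq : p < q) (hx : 0 < x) :
    potential p q x < Estar p q ↔ x < homoclinicMax p q := by
  have hq := hp.trans hpq
  rw [potential_eq_Estar_sub hp hq hx, homoclinicMax,
    Real.lt_rpow_inv_iff_of_pos hx.le (div_pos hq hp).le (sub_pos.2 hpq), sub_lt_self_iff,
    mul_pos_iff_of_pos_left (Real.rpow_pos_of_pos hx p), sub_pos, div_lt_div_iff₀ hq hp,
    lt_div_iff₀ hp, one_mul]

lemma one_lt_homoclinicMax (hp : 0 < p) (hpq : p < q) : 1 < homoclinicMax p q :=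
  Real.one_lt_rpow ((one_lt_div hp).2 hpq) (inv_pos.2 (sub_pos.2 hpq))

lemma potential_homoclinicMax (hp : 0 < p) (hpq : p < q) :
    potential p q (homoclinicMax p q) = Estar p q := by
  have hq := hp.trans hpq
  rw [potential_eq_Estar_sub hp hq (one_pos.trans (one_lt_homoclinicMax hp hpq)), homoclinicMax,
    Real.rpow_inv_rpow (div_pos hq hp).le (sub_pos.2 hpq).ne', div_div_cancel_left' hq.ne',
    one_div, sub_self, mul_zero, sub_zero]

lemma Estar_sub_potential_le (hp : 0 < p) (hpq : p < q) (hx : 0 < x) :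
    Estar p q - potential p q x ≤ 1 / p * x ^ p := by
  have hq := hp.trans hpq
  have h : 0 ≤ x ^ p * (x ^ (q - p) / q) := by positivity
  rw [potential_eq_Estar_sub hp hq hx]
  linarith

lemma isPotentialWell_potential (hp : 1 < p) (hpq : p < q) :
    IsPotentialWell (potential p q) (potentialDeriv p q) 0 1 (homoclinicMax p q) where
  mem := ⟨one_pos, one_lt_homoclinicMax (one_pos.trans hp) hpq⟩
  map_bottom := potential_one
  map_right := potential_homoclinicMax (one_pos.trans hp) hpq
  continuousOn x _ := (hasDerivAt_potential hp (hp.trans hpq) x).continuousAt.continuousWithinAt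
  hasDerivAt x _ := hasDerivAt_potential hp (hp.trans hpq) x
  continuousOn_deriv := (continuous_potentialDeriv hp (hp.trans hpq)).continuousOn
  neg_of_lt _ hx := potentialDeriv_neg hp hpq hx.1 hx.2
  pos_of_gt _ hx := potentialDeriv_pos hp hpq hx.1

/-! ### Chicone's condition for the potential -/

/-- The constant `V'''(1) / (6 * V''(1) ^ 2)`; any other choice makes the quantity in `chicone`
change sign at the bottom of the well. -/
noncomputable def chiconeConst (p q : ℝ) : ℝ := (q + p - 3) / (6 * (q - p))

lemma chiconeConst_pos (hp : 2 < p) (hpq : p < q) : 0 < chiconeConst p q :=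
  div_pos (by linarith) (by linarith)

/-- The factor of constant sign on either side of the bottom in the derivative
`V' ^ 2 / V'' ^ 2 * chiconeNumerator` of `V' ^ 2 * (1 / 2 + k * V') / V'' - V`. -/
noncomputable def chiconeNumerator (p q x : ℝ) : ℝ :=
  3 * chiconeConst p q * potentialDeriv₂ p q x ^ 2 -
    (1 / 2 + chiconeConst p q * potentialDeriv p q x) * potentialDeriv₃ p q x

/-- The coefficient of `z - 1`, where `z = x ^ (q - p)`, in `chiconeNumerator_of_pos`. -/
noncomputable def chiconeFactor (p q z : ℝ) : ℝ :=
  ((q + p - 3) * (5 * q - p - 3) - 3 * (q - 1) * (q - 2)) / 6 +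
    chiconeConst p q * (q - 1) * (2 * q - 1) * (z - 1)

lemma chiconeNumerator_of_pos (hp : 1 < p) (hpq : p < q) (hx : 0 < x) :
    chiconeNumerator p q x = x ^ (p - 3) *
      (x ^ (p - 1) * chiconeFactor p q (x ^ (q - p)) * (x ^ (q - p) - 1) +
        ((q - 1) * (q - 2) * x ^ (q - p) - (p - 1) * (p - 2)) / 2 * (x ^ (p - 1) - 1)) := by
  have hu : x ^ (p - 1) = x ^ (p - 3) * x ^ 2 := by
    rw [← Real.rpow_two, ← Real.rpow_add hx, show p - 3 + 2 = p - 1 by ring]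
  have hd : q - p ≠ 0 := (sub_pos.2 hpq).ne'
  rw [chiconeNumerator, chiconeFactor, potentialDeriv_of_pos hp (hp.trans hpq) hx,
    potentialDeriv₂_of_pos hx, potentialDeriv₃_of_pos hx, hu, chiconeConst]
  field_simp
  ring

lemma chiconeFactor_pos (hp : 2 < p) (hpq : p < q) {z : ℝ} (hz : p - 1 < (q - 1) * z) :
    0 < chiconeFactor p q z := by
  have hd : 0 < q - p := sub_pos.2 hpq
  have hz' : -(q - p) ≤ (q - 1) * (z - 1) := by linarith
  have hlin : chiconeConst p q * (2 * q - 1) * (-(q - p)) ≤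
      chiconeConst p q * (2 * q - 1) * ((q - 1) * (z - 1)) :=
    mul_le_mul_of_nonneg_left hz' (mul_nonneg (chiconeConst_pos hp hpq).le (by linarith))
  have hmin : chiconeConst p q * (2 * q - 1) * (-(q - p)) = -((q + p - 3) * (2 * q - 1) / 6) := by
    rw [chiconeConst]
    field_simp
  rw [chiconeFactor]
  nlinarith [mul_pos (sub_pos.2 hp) hd]

lemma sub_one_mul_rpow_sub_one_nonneg {a : ℝ} (ha : 0 ≤ a) (hx : 0 ≤ x) :
    0 ≤ (x - 1) * (x ^ a - 1) := by
  rcases le_total 1 x with h | h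
  · exact mul_nonneg (sub_nonneg.2 h) (sub_nonneg.2 (Real.one_le_rpow h ha))
  · exact mul_nonneg_of_nonpos_of_nonpos (sub_nonpos.2 h)
      (sub_nonpos.2 (Real.rpow_le_one hx h ha))

lemma sub_one_mul_chiconeNumerator_nonneg (hp : 2 < p) (hpq : p < q) (hx : 0 < x)
    (h : 0 < potentialDeriv₂ p q x) : 0 ≤ (x - 1) * chiconeNumerator p q x := by
  have hz := (potentialDeriv₂_pos_iff hx).1 h
  have hG := chiconeFactor_pos hp hpq hz
  have hC : 0 ≤ (q - 1) * (q - 2) * x ^ (q - p) - (p - 1) * (p - 2) := by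
    nlinarith [mul_lt_mul_of_pos_right hz (show 0 < q - 2 by linarith)]
  have h₁ := sub_one_mul_rpow_sub_one_nonneg (sub_pos.2 hpq).le hx.le
  have h₂ := sub_one_mul_rpow_sub_one_nonneg (a := p - 1) (by linarith) hx.le
  have key : 0 ≤ x ^ (p - 3) *
      (x ^ (p - 1) * chiconeFactor p q (x ^ (q - p)) * ((x - 1) * (x ^ (q - p) - 1)) +
        ((q - 1) * (q - 2) * x ^ (q - p) - (p - 1) * (p - 2)) / 2 *
          ((x - 1) * (x ^ (p - 1) - 1))) := by
    positivity
  rw [chiconeNumerator_of_pos (by linarith) hpq hx]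
  exact key.trans_eq (by ring)

lemma neg_div_le_potentialDeriv (hp : 1 < p) (hpq : p < q) (hx : 0 < x) :
    -((q - p) / (q - 1)) ≤ potentialDeriv p q x := by
  have hq₁ : 0 < q - 1 := by linarith
  have hu : 0 < x ^ (q - 1) := Real.rpow_pos_of_pos hx _
  have bernoulli := rpow_one_add_le_one_add_mul_self (s := x ^ (q - 1) - 1) (by linarith)
    (p := (p - 1) / (q - 1)) (div_nonneg (by linarith) hq₁.le) ((div_le_one hq₁).2 (by linarith))
  rw [add_sub_cancel, ← Real.rpow_mul hx.le, mul_div_cancel₀ _ hq₁.ne',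
    show (p - 1) / (q - 1) = 1 - (q - p) / (q - 1) by field_simp; ring] at bernoulli
  have hpos : 0 < (q - p) / (q - 1) * x ^ (q - 1) := mul_pos (div_pos (by linarith) hq₁) hu
  rw [potentialDeriv, phi_of_nonneg (hp.trans hpq).ne' hx.le, phi_of_nonneg hp.ne' hx.le]
  linarith

lemma half_add_chiconeConst_mul_nonneg (hp : 2 < p) (hpq : p < q) (hx : 0 < x) :
    0 ≤ 1 / 2 + chiconeConst p q * potentialDeriv p q x := by
  have hq₁ : 0 < q - 1 := by linarith
  have hk : chiconeConst p q * ((q - p) / (q - 1)) ≤ 1 / 2 := by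
    rw [chiconeConst, div_mul_div_comm,
      div_le_iff₀ (mul_pos (mul_pos (by norm_num) (sub_pos.2 hpq)) hq₁)]
    nlinarith
  have := mul_le_mul_of_nonneg_left (neg_div_le_potentialDeriv (by linarith) hpq hx)
    (chiconeConst_pos hp hpq).le
  linarith

lemma hasDerivAt_chicone_quotient (hp : 1 < p) (hq : 1 < q) (hx : 0 < x)
    (h : 0 < potentialDeriv₂ p q x) :
    HasDerivAt (fun x => potentialDeriv p q x ^ 2 *
        (1 / 2 + chiconeConst p q * potentialDeriv p q x) / potentialDeriv₂ p q x -
          potential p q x)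
      (potentialDeriv p q x ^ 2 / potentialDeriv₂ p q x ^ 2 * chiconeNumerator p q x) x := by
  have hF := hasDerivAt_potentialDeriv hp hq hx
  have hK := (((hF.fun_pow 2).fun_mul
    ((hF.const_mul (chiconeConst p q)).const_add (1 / 2))).fun_div
      (hasDerivAt_potentialDeriv₂ hx) h.ne').fun_sub (hasDerivAt_potential hp hq x)
  refine hK.congr_deriv ?_
  rw [chiconeNumerator]
  field_simp
  push_cast
  ring

lemma potential_le_chicone_quotient (hp : 2 < p) (hpq : p < q) (hx : 0 < x)
    (h : 0 < potentialDeriv₂ p q x) :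
    potential p q x ≤ potentialDeriv p q x ^ 2 *
      (1 / 2 + chiconeConst p q * potentialDeriv p q x) / potentialDeriv₂ p q x := by
  have hp₁ : 1 < p := by linarith
  have hpos : ∀ y ∈ uIcc 1 x, 0 < y := fun y hy => (lt_min one_pos hx).trans_le hy.1
  have hpos₂ : ∀ y ∈ uIcc 1 x, 0 < potentialDeriv₂ p q y := fun y hy =>
    potentialDeriv₂_pos_of_mem_uIcc hp₁ hpq hx h hy
  have key := le_of_forall_hasDerivAt_of_mul_nonneg
    (fun y hy => hasDerivAt_chicone_quotient hp₁ (hp₁.trans hpq) (hpos y hy) (hpos₂ y hy))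
    fun y hy => by
      rw [mul_left_comm]
      exact mul_nonneg (by positivity)
        (sub_one_mul_chiconeNumerator_nonneg hp hpq (hpos y hy) (hpos₂ y hy))
  simpa [potential_one, potentialDeriv, phi] using key

lemma chicone_potential (hp : 2 < p) (hpq : p < q) (hx : 0 < x) (hV : 0 ≤ potential p q x) :
    0 ≤ potentialDeriv p q x ^ 2 / 2 - potential p q x * potentialDeriv₂ p q x +
      chiconeConst p q * potentialDeriv p q x ^ 3 := by
  rcases lt_or_ge 0 (potentialDeriv₂ p q x) with h | h
  · have := (le_div_iff₀ h).1 (potential_le_chicone_quotient hp hpq hx h)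
    linarith
  · have hF := mul_nonneg (sq_nonneg (potentialDeriv p q x))
      (half_add_chiconeConst_mul_nonneg hp hpq hx)
    have hVF := mul_nonpos_of_nonneg_of_nonpos hV h
    linarith

theorem isChiconeWell_potential (hp : 2 < p) (hpq : p < q) :
    IsChiconeWell (potential p q) (potentialDeriv p q) (potentialDeriv₂ p q) (chiconeConst p q)
      0 1 (homoclinicMax p q) :=
  have hp₁ : 1 < p := by linarith
  have W := isPotentialWell_potential hp₁ hpq
  { W with
    hasDerivAt_deriv := fun _ hx => hasDerivAt_potentialDeriv hp₁ (hp₁.trans hpq) hx.1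
    chicone := fun _ hx =>
      chicone_potential hp hpq hx.1 (W.map_nonneg (Ioo_subset_Icc_self hx)) }

/-! ### Positive periodic solutions -/

lemma isTrajectory_iff : IsTrajectory p (potential p q) (potentialDeriv p q) E w ↔
    IsSolution p q w ∧ HasEnergy p q w E := by
  refine ⟨fun h => ⟨⟨h.differentiable, fun t => (h.hasDerivAt_phi_deriv t).differentiableAt,
    fun t => ?_⟩, h.energy_eq⟩, fun ⟨⟨hw, hphi, heq⟩, hE⟩ => ⟨hw, fun t => ?_, hE⟩⟩
  · rw [(h.hasDerivAt_phi_deriv t).deriv, potentialDeriv]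
    ring
  · refine (hphi t).hasDerivAt.congr_deriv ?_
    rw [potentialDeriv]
    linarith [heq t]

lemma IsSolution.exists_isTrajectory (hp : 1 < p) (hq : 1 < q) (hw : IsSolution p q w) :
    ∃ E, IsTrajectory p (potential p q) (potentialDeriv p q) E w := by
  refine PLaplace.exists_isTrajectory hp hw.1 (fun t => ?_) fun x => hasDerivAt_potential hp hq _
  refine (hw.2.1 t).hasDerivAt.congr_deriv ?_
  rw [potentialDeriv]
  linarith [hw.2.2 t]

lemma IsTrajectory.mem_Ioo_homoclinicMax
    (h : IsTrajectory p (potential p q) (potentialDeriv p q) E w) (hp : 1 < p) (hpq : p < q)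
    (hpos : ∀ t, 0 < w t) (hE : E < Estar p q) (t : ℝ) : w t ∈ Ioo 0 (homoclinicMax p q) :=
  ⟨hpos t, (potential_lt_Estar_iff (one_pos.trans hp) hpq (hpos t)).1
    ((h.potential_le hp t).trans_lt hE)⟩

namespace IsPositivePeriodicSolution

theorem exists_hasEnergy (hw : IsPositivePeriodicSolution p q w) (hp : 1 < p) (hpq : p < q) :
    ∃ E, 0 ≤ E ∧ E < Estar p q ∧ HasEnergy p q w E := by
  have hp₀ : 0 < p := one_pos.trans hp
  obtain ⟨hsol, hpos, S, hS, hper⟩ := hw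
  obtain ⟨E, h⟩ := hsol.exists_isTrajectory hp (hp.trans hpq)
  obtain ⟨t₁, hF⟩ := h.exists_nonpos_of_periodic hS hper
  obtain ⟨t₀, hmin, hderiv⟩ := h.exists_isLeast_range hS hper
  have hle : w t₀ ≤ 1 := (hmin.2 (mem_range_self t₁)).trans
    (not_lt.1 fun hlt => (potentialDeriv_pos hp hpq hlt).not_ge hF)
  have hmem : w t₀ < homoclinicMax p q := hle.trans_lt (one_lt_homoclinicMax hp₀ hpq)
  rw [← (h.deriv_eq_zero_iff hp t₀).1 hderiv] at h
  exact ⟨_, (isPotentialWell_potential hp hpq).map_nonneg ⟨(hpos t₀).le, hmem.le⟩,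
    (potential_lt_Estar_iff hp₀ hpq (hpos t₀)).2 hmem, h.energy_eq⟩

theorem isMinimalPeriod (hw : IsPositivePeriodicSolution p q w) (hp : 2 < p) (hpq : p < q)
    (hE : E ∈ Ioo 0 (Estar p q)) (hwE : HasEnergy p q w E) :
    IsMinimalPeriod w (period p (potential p q) 0 (homoclinicMax p q) E) := by
  have hp₁ : 1 < p := one_lt_two.trans hp
  have W := isChiconeWell_potential hp hpq
  have h := isTrajectory_iff.2 ⟨hw.1, hwE⟩
  exact W.isMinimalPeriod hp₁ hE (W.integrableOn_slowness hp₁ hE) h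
    (h.mem_Ioo_homoclinicMax hp₁ hpq hw.2.1 hE.2) hw.2.2

end IsPositivePeriodicSolution

theorem exists_isPositivePeriodicSolution (hp : 2 < p) (hpq : p < q)
    (hE : E ∈ Ioo 0 (Estar p q)) : ∃ w, IsPositivePeriodicSolution p q w ∧ HasEnergy p q w E := by
  have hp₁ : 1 < p := one_lt_two.trans hp
  have W := isChiconeWell_potential hp hpq
  obtain ⟨w, h, hmem, hper⟩ :=
    W.exists_periodic_isTrajectory hp₁ hE (W.integrableOn_slowness hp₁ hE)
  obtain ⟨hsol, henergy⟩ := isTrajectory_iff.1 h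
  exact ⟨w, ⟨hsol, fun t => (hmem t).1, hper⟩, henergy⟩

end

end PLaplace

theorem theorem1p3 (p q : ℝ) (hp : 2 < p) (hpq : p < q) :
    (∀ w : ℝ → ℝ, PLaplace.IsPositivePeriodicSolution p q w →
      ∃ E, 0 ≤ E ∧ E < PLaplace.Estar p q ∧ PLaplace.HasEnergy p q w E) ∧
    ∃ T : ℝ → ℝ,
      (∀ E ∈ Set.Ioo 0 (PLaplace.Estar p q),
        (∃ w : ℝ → ℝ, PLaplace.IsPositivePeriodicSolution p q w ∧ PLaplace.HasEnergy p q w E) ∧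
        ∀ w : ℝ → ℝ, PLaplace.IsPositivePeriodicSolution p q w → PLaplace.HasEnergy p q w E →
          PLaplace.IsMinimalPeriod w (T E)) ∧
      StrictMonoOn T (Set.Ioo 0 (PLaplace.Estar p q)) ∧
      Filter.Tendsto T (nhdsWithin 0 (Set.Ioi 0)) (nhds 0) ∧
      Filter.Tendsto T (nhdsWithin (PLaplace.Estar p q) (Set.Iio (PLaplace.Estar p q)))
        Filter.atTop := by
  have hp₁ : 1 < p := one_lt_two.trans hp
  have hp₀ : 0 < p := one_pos.trans hp₁
  have W := PLaplace.isChiconeWell_potential hp hpq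
  refine ⟨fun w hw => hw.exists_hasEnergy hp₁ hpq,
    PLaplace.period p (PLaplace.potential p q) 0 (PLaplace.homoclinicMax p q),
    fun E hE => ⟨PLaplace.exists_isPositivePeriodicSolution hp hpq hE,
      fun w hw hwE => hw.isMinimalPeriod hp hpq hE hwE⟩,
    W.strictMonoOn_period hp, W.tendsto_period_zero hp, ?_⟩
  refine W.tendsto_period_atTop hp₁ (fun E hE => W.integrableOn_slowness hp₁ hE)
    (one_div_pos.2 hp₀) fun x hx => ?_
  rw [sub_zero]
  exact PLaplace.Estar_sub_potential_le hp₀ hpq hx.1
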